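/- **Proposition 1 (Heterogeneous Manifold).** Let $k\ge 0$, $d_1,\dots,d_k\in\mathbb N$ and $\kappa_1,\dots,\kappa_k\in\mathbb R$, and let $\mathcal P=\prod_{m=1}^{k}\mathbb G^{d_m}_{\kappa_m}$ be the Riemannian product of the $\kappa$-stereographic models $\mathbb G^{d}_{\kappa}=\{x\in\mathbb R^{d}: -\kappa|x|^2<1\}$ with metric $\left(\frac{2}{1+\kappa|x|^2}\right)^2\langle\cdot,\cdot\rangle$. Let $n\ge 2$ and $0<R\le\infty$, and let $\mathcal F$ be the $n$-dimensional rotational factor, written in geodesic polar coordinates $x=r\omega$ ($0\le r<R$, $\omega\in\mathbb S^{n-1}$) about its pole as the ball $\{x\in\mathbb R^n:|x|<R\}$ (for $R=\frac{\pi}{2\sqrt c}$ this is the open upper hemisphere of radius $\frac{1}{\sqrt c}$), with the rotationally symmetric metric $g_\rho=dr^2+\rho(r)^2g_{\mathbb S^{n-1}}$ (Euclidean inner product at $r=0$), where $\rho$ is smooth and odd on $(-R,R)$, positive on $(0,R)$, and $\rho'(0)=1$. Let $\mathcal M=\mathcal P\otimes\mathcal F$ be the Riemannian product. The curvature $\kappa_x$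 at a point $x$ is the sum of the sectional curvatures $K(e_i,e_j)$ over all ordered pairs $i\ne j$ of an orthonormal basis $(e_i)$ of the tangent space at $x$. The manifold $\mathcal M$ is called heterogeneous if its sectional curvature depends on the point, that is, if there are $x,y\in\mathcal M$ such that no linear isometry $T_x\mathcal M\to T_y\mathcal M$ preserves the sectional curvatures of all planes. Put $$\kappa_{\mathcal P}=\sum_{m=1}^{k}d_m(d_m-1)\kappa_m,\qquad \kappa_{\mathrm{rot}}(r)=(n-1)\left(-2\frac{\rho''(r)}{\rho(r)}+(n-2)\frac{1-\rho'(r)^2}{\rho(r)^2}\right)\quad(0<r<R),$$ and $\kappa_{\mathrm{rot}}(0)=-n(n-1)\rho'''(0)=\lim_{r\to0}\kappa_{\mathrm{rot}}(r)$. Then, for every such $\rho$: 1. $\mathcal M$ is a smooth Riemannian manifold; 2. the curvature of $\mathcal P$ equals the constant $\kappa_{\mathcal P}$ at every point, and the curvature of $\mathcal M$ at every point $x$ is $\kappa_x=\kappa_{\mathcal P}+\kappa_{\mathrm{rot}}(r)$, where $r$ is the radial coordinate of the $\mathcal F$-component of $x$; 3. $\mathcal M$ is heterogeneous if and only if $\kappa_{\mathrm{rot}}$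 is not constant on $[0,R)$, and this is the case if and only if $\rho$ is not on $[0,R)$ one of the constant-curvature profiles $\frac{\sin(\sqrt c\,r)}{\sqrt c}$ $(c>0)$, $r$, $\frac{\sinh(\sqrt{-c}\,r)}{\sqrt{-c}}$ $(c<0)$. Moreover, for all $k$, $d_m$, $\kappa_m$, $n\ge2$ and $R$ as above there is such a $\rho$ for which $\mathcal M$ is heterogeneous. -/

import Mathlib

open scoped ContDiff

noncomputable section

/-! ## Riemannian metrics and curvature in a global chart

All the manifolds below are covered by one chart: they are open subsets `U` of a finite-dimensional
real vector space `E`, and a Riemannian metric on `U` is a field `g` of inner products on `E`. -/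

namespace Riem

variable {E : Type*} [NormedAddCommGroup E] [NormedSpace ℝ E]

/-- `g` is a smooth Riemannian metric on the open set `U`. -/
structure IsRiemannianMetricOn (g : E → E →L[ℝ] E →L[ℝ] ℝ) (U : Set E) : Prop where
  isOpen : IsOpen U
  smooth : ContDiffOn ℝ ∞ g U
  symm : ∀ x ∈ U, ∀ u v, g x u v = g x v u
  pos : ∀ x ∈ U, ∀ v, v ≠ 0 → 0 < g x v v

/-- The Christoffel map of `g` at `x` (the Levi-Civita derivative of the constant field `v` in the
direction `u`): the vector `Γ` with
`g (Γ, w) = (1/2) (D_u g (v, w) + D_v g (u, w) - D_w g (u, v))` for all `w`. -/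
def christoffel (g : E → E →L[ℝ] E →L[ℝ] ℝ) (x u v : E) : E :=
  (g x).inverse ((1 / 2 : ℝ) •
    (fderiv ℝ g x u v + fderiv ℝ g x v u - ((fderiv ℝ g x).flip u).flip v))

/-- The Riemann curvature `R(u, v) w = ∇_u ∇_v w - ∇_v ∇_u w` of constant fields `u, v, w`. -/
def riemann (g : E → E →L[ℝ] E →L[ℝ] ℝ) (x u v w : E) : E :=
  fderiv ℝ (fun y => christoffel g y v w) x u - fderiv ℝ (fun y => christoffel g y u w) x v
    + christoffel g x u (christoffel g x v w) - christoffel g x v (christoffel g x u w)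

/-- The sectional curvature at `x` of the plane spanned by the linearly independent `u, v`. -/
def sectional (g : E → E →L[ℝ] E →L[ℝ] ℝ) (x u v : E) : ℝ :=
  g x (riemann g x u v v) u / (g x u u * g x v v - g x u v ^ 2)

/-- `e` is an orthonormal frame of the tangent space at `x`. -/
def IsFrame (g : E → E →L[ℝ] E →L[ℝ] ℝ) (x : E)
    (e : Module.Basis (Fin (Module.finrank ℝ E)) ℝ E) : Prop :=
  ∀ i j, g x (e i) (e j) = if i = j then 1 else 0

/-- The curvature `κ_x` of the space at the point `x` is `c`: the sectional curvatures of the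
coordinate planes of an orthonormal frame at `x`, summed over all ordered pairs of distinct frame
vectors, add up to `c`, for every orthonormal frame (and frames exist). -/
def HasCurvature (g : E → E →L[ℝ] E →L[ℝ] ℝ) (x : E) (c : ℝ) : Prop :=
  (∃ e, IsFrame g x e) ∧
    ∀ e, IsFrame g x e →
      ∑ i, ∑ j ∈ Finset.univ.filter (fun j => j ≠ i), sectional g x (e i) (e j) = c

/-- The sectional curvature is the same at `x` and at `y`: some linear isometry between the two
tangent spaces preserves the sectional curvature of every plane. -/
def SameSectional (g : E → E →L[ℝ] E →L[ℝ] ℝ) (x y : E) : Prop :=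
  ∃ L : E ≃ₗ[ℝ] E, (∀ u v, g y (L u) (L v) = g x u v) ∧
    ∀ u v, LinearIndependent ℝ ![u, v] → sectional g y (L u) (L v) = sectional g x u v

/-- `(U, g)` is heterogeneous: its sectional curvature depends on the point. -/
def IsHeterogeneous (g : E → E →L[ℝ] E →L[ℝ] ℝ) (U : Set E) : Prop :=
  ∃ x ∈ U, ∃ y ∈ U, ¬ SameSectional g x y

/-! ### Product metrics -/

/-- The Riemannian product of finitely many metrics. -/
def piMetric {ι : Type*} [Fintype ι] {V : ι → Type*} [∀ i, NormedAddCommGroup (V i)]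
    [∀ i, NormedSpace ℝ (V i)] (g : ∀ i, V i → V i →L[ℝ] V i →L[ℝ] ℝ) :
    (∀ i, V i) → (∀ i, V i) →L[ℝ] (∀ i, V i) →L[ℝ] ℝ :=
  fun x => ∑ i, (g i (x i)).bilinearComp (ContinuousLinearMap.proj i) (ContinuousLinearMap.proj i)

/-- The Riemannian product of two metrics. -/
def prodMetric {F : Type*} [NormedAddCommGroup F] [NormedSpace ℝ F]
    (g : E → E →L[ℝ] E →L[ℝ] ℝ) (h : F → F →L[ℝ] F →L[ℝ] ℝ) :
    E × F → (E × F) →L[ℝ] (E × F) →L[ℝ] ℝ :=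
  fun x => (g x.1).bilinearComp (.fst ℝ E F) (.fst ℝ E F)
    + (h x.2).bilinearComp (.snd ℝ E F) (.snd ℝ E F)

/-! ### The factors -/

/-- The Euclidean inner product as a bilinear form. -/
def euclid (n : ℕ) :
    EuclideanSpace ℝ (Fin n) →L[ℝ] EuclideanSpace ℝ (Fin n) →L[ℝ] ℝ :=
  innerSL ℝ

/-- The `κ`-stereographic model `{x ∈ ℝ^d | -κ |x|² < 1}`. -/
def stereo (κ : ℝ) (d : ℕ) : Set (EuclideanSpace ℝ (Fin d)) :=
  {x | -κ * ‖x‖ ^ 2 < 1}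

/-- Its metric `(λ_x)² ⟨·, ·⟩` with conformal factor `λ_x = 2 / (1 + κ |x|²)`. -/
def stereoMetric (κ : ℝ) (d : ℕ) (x : EuclideanSpace ℝ (Fin d)) :
    EuclideanSpace ℝ (Fin d) →L[ℝ] EuclideanSpace ℝ (Fin d) →L[ℝ] ℝ :=
  (2 / (1 + κ * ‖x‖ ^ 2)) ^ 2 • euclid d

/-- The profile `ρ` of a rotationally symmetric metric of radius `R ≤ ∞`: smooth and odd on
`(-R, R)`, positive on `(0, R)`, with `ρ'(0) = 1`. -/
structure IsProfile (R : ENNReal) (ρ : ℝ → ℝ) : Prop where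
  smooth : ContDiffOn ℝ ∞ ρ {r | ENNReal.ofReal |r| < R}
  odd : ∀ r, ENNReal.ofReal |r| < R → ρ (-r) = -ρ r
  pos : ∀ r, 0 < r → ENNReal.ofReal r < R → 0 < ρ r
  deriv_zero : deriv ρ 0 = 1

/-- The form `dr²` at `x ≠ 0`, where `r = |x|`. -/
def drSq (n : ℕ) (x : EuclideanSpace ℝ (Fin n)) :
    EuclideanSpace ℝ (Fin n) →L[ℝ] EuclideanSpace ℝ (Fin n) →L[ℝ] ℝ :=
  (‖x‖ ^ 2)⁻¹ • (euclid n x).smulRight (euclid n x)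

/-- The pullback at `x ≠ 0` of the round metric of the unit sphere by `x ↦ x / |x|`. -/
def sphereForm (n : ℕ) (x : EuclideanSpace ℝ (Fin n)) :
    EuclideanSpace ℝ (Fin n) →L[ℝ] EuclideanSpace ℝ (Fin n) →L[ℝ] ℝ :=
  (‖x‖ ^ 2)⁻¹ • (euclid n - drSq n x)

/-- The rotationally symmetric metric `dr² + ρ(r)² g_S` in polar coordinates `x = r ω` about the
origin; at the origin itself it is the Euclidean inner product. -/
def rotMetric (n : ℕ) (ρ : ℝ → ℝ) (x : EuclideanSpace ℝ (Fin n)) :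
    EuclideanSpace ℝ (Fin n) →L[ℝ] EuclideanSpace ℝ (Fin n) →L[ℝ] ℝ :=
  open Classical in
  if x = 0 then euclid n else drSq n x + ρ ‖x‖ ^ 2 • sphereForm n x

/-- The rotational factor: the open upper hemisphere in geodesic polar coordinates `x = r ω` about
its pole, `0 ≤ r < R` (`R = π / (2 √c)` for the hemisphere of radius `1 / √c`). -/
def rotDomain (n : ℕ) (R : ENNReal) : Set (EuclideanSpace ℝ (Fin n)) :=
  {x | ENNReal.ofReal ‖x‖ < R}

/-- The rotational curvature `κ_rot(r)` of the `n`-dimensional rotational factor; at `r = 0`, where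
the quotients are not defined, it is their limit for `r → 0`. -/
def kappaRot (n : ℕ) (ρ : ℝ → ℝ) (r : ℝ) : ℝ :=
  open Classical in
  if r = 0 then -((n : ℝ) * ((n : ℝ) - 1) * iteratedDeriv 3 ρ 0)
  else ((n : ℝ) - 1) *
    (-2 * (deriv (deriv ρ) r / ρ r) + ((n : ℝ) - 2) * ((1 - deriv ρ r ^ 2) / ρ r ^ 2))

/-- The profile of the space form of constant curvature `c`. -/
def spaceFormProfile (c r : ℝ) : ℝ :=
  open Classical in
  if 0 < c then Real.sin (√c * r) / √c
  else if c < 0 then Real.sinh (√(-c) * r) / √(-c)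
  else r

/-! ### The rotational product -/

/-- The product `P` of `κ`-stereographic models, as a set. -/
def homDomain {k : ℕ} (d : Fin k → ℕ) (κ : Fin k → ℝ) :
    Set (∀ m, EuclideanSpace ℝ (Fin (d m))) :=
  {p | ∀ m, p m ∈ stereo (κ m) (d m)}

/-- The metric of `P`. -/
def homMetric {k : ℕ} (d : Fin k → ℕ) (κ : Fin k → ℝ) :=
  piMetric (fun m => stereoMetric (κ m) (d m))

/-- The constant curvature of `P`. -/
def kappaHom {k : ℕ} (d : Fin k → ℕ) (κ : Fin k → ℝ) : ℝ :=
  ∑ m, (d m : ℝ) * ((d m : ℝ) - 1) * κ m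

/-- The rotational product `M = P ⊗ F`, as a set. -/
def rotProduct {k : ℕ} (d : Fin k → ℕ) (κ : Fin k → ℝ) (n : ℕ) (R : ENNReal) :
    Set ((∀ m, EuclideanSpace ℝ (Fin (d m))) × EuclideanSpace ℝ (Fin n)) :=
  homDomain d κ ×ˢ rotDomain n R

/-- The metric of `M = P ⊗ F`. -/
def rotProductMetric {k : ℕ} (d : Fin k → ℕ) (κ : Fin k → ℝ) (n : ℕ) (ρ : ℝ → ℝ) :=
  prodMetric (homMetric d κ) (rotMetric n ρ)

end Riem

end

/-!
The manifold is covered by one chart, so its curvature is computed from the Christoffel map, which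
Koszul's formula determines (`christoffel_eq`). In a Riemannian product the Christoffel map and the
curvature tensor split (`riemann_prod`, `riemann_pi`), so that the form `g (R(u, v) v, u)`
(`curvForm`) of the product is the sum of those of the factors.

Both kinds of factors are invariant under rotations. Their Christoffel maps have the shape
`p (⟨x, u⟩ v + ⟨x, v⟩ u) + (q ⟨x, u⟩ ⟨x, v⟩ + s ⟨u, v⟩) x` with coefficients that depend on `|x|`
only, and one calculation (`riemann_of_radialChristoffel`) gives the curvature of all of them. For
the stereographic models it is `κ` times the squared area. The rotational metric is smooth at the
pole as well, because it equals `a(|x|)² ⟨·, ·⟩ + b(|x|) ⟨x, ·⟩ ⟨x, ·⟩` for the smooth even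
functions `a(r) = ρ(r) / r` and `b(r) = (1 - a(r)²) / r²`: the quotients are smooth by Hadamard's
lemma (`contDiff_dslope_zero`), and an even smooth function of `|x|` is smooth (`contDiff_radial`).
In these coordinates its curvature form is `α · area + β · radialArea` at every point, the pole
included, where `α = (1 - ρ'²) / ρ²` and `α + r² β = -ρ'' / ρ` for `r > 0`, and `α = -ρ''' (0)` at
the pole (`IsProfile.exists_curvForm`). Summing over an orthonormal frame, by Parseval and because
the trace of an orthogonal projection is the dimension of its image, gives the stated curvatures
(`hasCurvature_hom`, `hasCurvature_rotProduct`).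

If `κ_rot` takes two values, so does the curvature, which every isometry that preserves the
sectional curvatures preserves (`SameSectional.hasCurvature_unique`); hence the product is
heterogeneous. If `κ_rot` has the constant value `n (n - 1) c`, then `ρⁿ⁻² (1 - ρ'²) - c ρⁿ` is
constant along `[0, R)` and vanishes at `0`, so `ρ'' = -c ρ` and `ρ` is a space form profile
(`IsProfile.exists_eq_spaceFormProfile`). Over a space form profile the product is a product of
space forms, in which any two points are related by an isometry of tangent spaces that respects the
factors and hence the sectional curvatures (`not_isHeterogeneous_of_spaceFormProfile`). The profile
`r + r³` is an example in which `κ_rot` is not constant.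
-/

noncomputable section

namespace Riem

/-! ### Smooth even functions of the norm -/

lemma hasDerivAt_integral_pow_mul_comp {g : ℝ → ℝ} (hg : ContDiff ℝ ∞ g) (k : ℕ) (r : ℝ) :
    HasDerivAt (fun r => ∫ t in (0 : ℝ)..1, t ^ k * g (t * r))
      (∫ t in (0 : ℝ)..1, t ^ (k + 1) * deriv g (t * r)) r := by
  have hg0 : Continuous g := hg.continuous
  have hg1 : Continuous (deriv g) := hg.continuous_deriv (by simp)
  have hd : Differentiable ℝ g := hg.differentiable (by simp)
  obtain ⟨C, hC⟩ := ((isCompact_Icc (a := (0 : ℝ)) (b := 1)).prod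
    (isCompact_Icc (a := r - 1) (b := r + 1))).exists_bound_of_continuousOn
      (f := fun q : ℝ × ℝ => q.1 ^ (k + 1) * deriv g (q.1 * q.2)) (by fun_prop)
  refine (intervalIntegral.hasDerivAt_integral_of_dominated_loc_of_deriv_le
    (F' := fun r t => t ^ (k + 1) * deriv g (t * r)) (bound := fun _ => C)
    (Icc_mem_nhds (show r - 1 < r by linarith) (show r < r + 1 by linarith)) ?_ ?_ ?_ ?_ ?_ ?_).2
  · exact .of_forall fun x => Continuous.aestronglyMeasurable (by fun_prop)
  · exact Continuous.intervalIntegrable (by fun_prop) _ _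
  · exact Continuous.aestronglyMeasurable (by fun_prop)
  · refine .of_forall fun t ht x hx => hC (t, x) ⟨?_, hx⟩
    rw [Set.uIoc_of_le zero_le_one] at ht
    exact ⟨ht.1.le, ht.2⟩
  · exact intervalIntegrable_const
  · refine .of_forall fun t _ x _ => ?_
    have h1 : HasDerivAt (fun y => g (t * y)) (deriv g (t * x) * t) x := by
      refine (hd (t * x)).hasDerivAt.comp x ?_
      simpa using (hasDerivAt_id x).const_mul t
    exact (h1.const_mul (t ^ k)).congr_deriv (by ring)

/-- The weights `t ^ k` make the family of these integrals closed under differentiation. -/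
lemma contDiff_integral_pow_mul_comp (m : ℕ) {g : ℝ → ℝ} (hg : ContDiff ℝ ∞ g) (k : ℕ) :
    ContDiff ℝ m (fun r => ∫ t in (0 : ℝ)..1, t ^ k * g (t * r)) := by
  induction m generalizing g k with
  | zero =>
    have hd : Differentiable ℝ (fun r => ∫ t in (0 : ℝ)..1, t ^ k * g (t * r)) :=
      fun r => (hasDerivAt_integral_pow_mul_comp hg k r).differentiableAt
    exact contDiff_zero.2 hd.continuous
  | succ m ih =>
    rw [show ((m + 1 : ℕ) : WithTop ℕ∞) = (m : WithTop ℕ∞) + 1 by norm_cast,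
      contDiff_succ_iff_deriv]
    refine ⟨fun r => (hasDerivAt_integral_pow_mul_comp hg k r).differentiableAt, by simp, ?_⟩
    have : deriv (fun r => ∫ t in (0 : ℝ)..1, t ^ k * g (t * r)) =
        fun r => ∫ t in (0 : ℝ)..1, t ^ (k + 1) * deriv g (t * r) :=
      funext fun r => (hasDerivAt_integral_pow_mul_comp hg k r).deriv
    rw [this]
    exact ih ((contDiff_infty_iff_deriv.1 hg).2) (k + 1)

/-- Hadamard's lemma: the slope function of a smooth function, completed by the derivative, is
smooth. It is `∫₀¹ f' (t r) dt`. -/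
lemma contDiff_dslope_zero {f : ℝ → ℝ} (hf : ContDiff ℝ ∞ f) : ContDiff ℝ ∞ (dslope f 0) := by
  have hd : Differentiable ℝ f := hf.differentiable (by simp)
  have hf' : ContDiff ℝ ∞ (deriv f) := (contDiff_infty_iff_deriv.1 hf).2
  -- `t ^ 0` brings the integrand into the form that is stable under differentiation in `r`
  have : dslope f 0 = fun r => ∫ t in (0 : ℝ)..1, t ^ 0 * deriv f (t * r) := by
    funext r
    rcases eq_or_ne r 0 with rfl | hr
    · simp [dslope_same]
    · have h := intervalIntegral.integral_eq_sub_of_hasDerivAt (a := (0 : ℝ)) (b := 1)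
        (f := fun t => f (t * r)) (f' := fun t => deriv f (t * r) * r)
        (fun t _ => by
          refine (hd (t * r)).hasDerivAt.comp t ?_
          simpa using (hasDerivAt_id t).mul_const r)
        (Continuous.intervalIntegrable (by have := hf'.continuous; fun_prop) _ _)
      rw [intervalIntegral.integral_mul_const] at h
      rw [dslope_of_ne _ hr, slope_def_field]
      simp only [pow_zero, one_mul]
      rw [div_eq_iff (by simpa using hr), sub_zero, h]
      simp
  rw [this]
  exact contDiff_infty.2 fun m => contDiff_integral_pow_mul_comp m hf' 0

lemma dslope_zero_of_ne {f : ℝ → ℝ} (h0 : f 0 = 0) {r : ℝ} (hr : r ≠ 0) :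
    dslope f 0 r = f r / r := by
  rw [dslope_of_ne _ hr, slope_def_field, h0, sub_zero, sub_zero]

lemma mul_dslope_zero {f : ℝ → ℝ} (h0 : f 0 = 0) (r : ℝ) : r * dslope f 0 r = f r := by
  simpa [h0] using sub_smul_dslope f 0 r

lemma even_dslope_of_odd {f : ℝ → ℝ} (hf : f.Odd) : (dslope f 0).Even := by
  intro r
  rcases eq_or_ne r 0 with rfl | hr
  · simp
  · have h0 := Function.Odd.map_zero hf
    rw [dslope_zero_of_ne h0 hr, dslope_zero_of_ne h0 (neg_ne_zero.2 hr), hf, neg_div_neg_eq]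

lemma odd_deriv_of_even {f : ℝ → ℝ} (hf : f.Even) : (deriv f).Odd := by
  intro r
  have h : deriv (fun x => f (-x)) r = -deriv f (-r) := deriv_comp_neg f r
  rw [show (fun x => f (-x)) = f from funext hf] at h
  linarith

lemma odd_dslope_of_even {f : ℝ → ℝ} (hf : f.Even) (h0 : f 0 = 0) :
    (dslope f 0).Odd := by
  intro r
  rcases eq_or_ne r 0 with rfl | hr
  · simpa [dslope_same] using odd_deriv_of_even hf 0
  · rw [dslope_zero_of_ne h0 hr, dslope_zero_of_ne h0 (neg_ne_zero.2 hr), hf, div_neg]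

/-- The radial derivative `f' (r) / r` of an even function, completed by `f'' (0)` at `r = 0`:
the function of `|x|` by which `x` is multiplied in the gradient of `f |x|`. -/
def radialDeriv (f : ℝ → ℝ) : ℝ → ℝ := dslope (deriv f) 0

lemma contDiff_radialDeriv {f : ℝ → ℝ} (hf : ContDiff ℝ ∞ f) : ContDiff ℝ ∞ (radialDeriv f) :=
  contDiff_dslope_zero ((contDiff_infty_iff_deriv.1 hf).2)

lemma even_radialDeriv {f : ℝ → ℝ} (hf : f.Even) : (radialDeriv f).Even :=
  even_dslope_of_odd (odd_deriv_of_even hf)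

lemma mul_radialDeriv {f : ℝ → ℝ} (hf : f.Even) (r : ℝ) : r * radialDeriv f r = deriv f r :=
  mul_dslope_zero (Function.Odd.map_zero (odd_deriv_of_even hf)) r

section Radial

variable {E : Type*} [NormedAddCommGroup E] [InnerProductSpace ℝ E]

/-- The gradient of `f |x|` is `f' (|x|) / |x|` times `x`, also at the origin. -/
lemma hasFDerivAt_radial {f : ℝ → ℝ} (hf : ContDiff ℝ ∞ f) (he : f.Even) (x : E) :
    HasFDerivAt (fun y : E => f ‖y‖) (radialDeriv f ‖x‖ • innerSL ℝ x) x := by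
  have hd : Differentiable ℝ f := hf.differentiable (by simp)
  rcases eq_or_ne x 0 with rfl | hx
  · have h1 : HasDerivAt f 0 ‖(0 : E)‖ := by
      have := (hd 0).hasDerivAt
      rw [(Function.Odd.map_zero (odd_deriv_of_even he))] at this
      simpa using this
    -- `f' (0) = 0`, so `f |y| - f 0` is `o(|y|)`
    have h2 := h1.isLittleO
    have h3 : Filter.Tendsto (fun y : E => ‖y‖) (nhds 0) (nhds ‖(0 : E)‖) :=
      continuous_norm.tendsto 0
    have h4 := h2.comp_tendsto h3
    rw [hasFDerivAt_iff_isLittleO]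
    simp only [map_zero, smul_zero, zero_apply, sub_zero, Function.comp_def,
      norm_zero] at h4 ⊢
    exact h4.of_norm_right
  · have hx' : ‖x‖ ≠ 0 := norm_ne_zero_iff.2 hx
    have h1 : HasFDerivAt (fun y : E => ‖y‖) (‖x‖⁻¹ • innerSL ℝ x) x := by
      have h := ((hasStrictFDerivAt_norm_sq x).hasFDerivAt).sqrt (by positivity)
      simp only [Real.sqrt_sq (norm_nonneg _)] at h
      convert h using 1
      ext y
      simp
      field_simp
    have h2 := (hd ‖x‖).hasDerivAt.comp_hasFDerivAt x h1
    rw [show radialDeriv f ‖x‖ • innerSL ℝ x = deriv f ‖x‖ • ‖x‖⁻¹ • innerSL ℝ x from ?_]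
    · exact h2
    rw [← mul_radialDeriv he, smul_smul]
    congr 1
    field_simp

/-- An even smooth function of the norm is smooth, also at the origin. -/
lemma contDiff_radial {f : ℝ → ℝ} (hf : ContDiff ℝ ∞ f) (he : f.Even) :
    ContDiff ℝ ∞ (fun y : E => f ‖y‖) := by
  refine contDiff_infty.2 fun m => ?_
  induction m generalizing f with
  | zero =>
    exact contDiff_zero.2 (hf.continuous.comp continuous_norm)
  | succ m ih =>
    rw [show ((m + 1 : ℕ) : WithTop ℕ∞) = (m : WithTop ℕ∞) + 1 by norm_cast,
      contDiff_succ_iff_fderiv]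
    refine ⟨fun x => (hasFDerivAt_radial hf he x).differentiableAt, by simp, ?_⟩
    rw [show fderiv ℝ (fun y : E => f ‖y‖) = fun x => radialDeriv f ‖x‖ • innerSL ℝ x from
      funext fun x => (hasFDerivAt_radial hf he x).fderiv]
    exact (ih (contDiff_radialDeriv hf) (even_radialDeriv he)).smul (innerSL ℝ).contDiff

end Radial

/-! ### The Christoffel map and orthonormal frames -/

variable {E : Type*} [NormedAddCommGroup E] [NormedSpace ℝ E]

lemma isInvertible_of_pos [FiniteDimensional ℝ E] {B : E →L[ℝ] E →L[ℝ] ℝ}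
    (hB : ∀ v, v ≠ 0 → 0 < B v v) : B.IsInvertible := by
  have hinj : Function.Injective B.toLinearMap := by
    rw [← LinearMap.ker_eq_bot, LinearMap.ker_eq_bot']
    intro v hv
    by_contra h
    have := hB v h
    rw [show B v = 0 from hv] at this
    simp at this
  have hfin : Module.finrank ℝ E = Module.finrank ℝ (E →L[ℝ] ℝ) := by
    rw [← (LinearMap.toContinuousLinearMap (𝕜 := ℝ) (E := E) (F' := ℝ)).finrank_eq]
    exact Subspace.dual_finrank_eq.symm
  let L := LinearMap.linearEquivOfInjective B.toLinearMap hinj hfin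
  refine ⟨L.toContinuousLinearEquiv, ?_⟩
  ext v
  rfl

/-- Koszul's formula determines the Christoffel map of a positive definite metric. -/
lemma christoffel_eq [FiniteDimensional ℝ E] {g : E → E →L[ℝ] E →L[ℝ] ℝ} {x u v Γ : E}
    (hpos : ∀ v, v ≠ 0 → 0 < g x v v)
    (h : ∀ w, 2 * g x Γ w = fderiv ℝ g x u v w + fderiv ℝ g x v u w - fderiv ℝ g x w u v) :
    christoffel g x u v = Γ := by
  rw [christoffel, (isInvertible_of_pos hpos).inverse_apply_eq]
  ext w
  simp only [smul_apply, add_apply,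
    sub_apply, ContinuousLinearMap.flip_apply, smul_eq_mul]
  linarith [h w]

lemma koszul [FiniteDimensional ℝ E] {g : E → E →L[ℝ] E →L[ℝ] ℝ} {x : E}
    (hpos : ∀ v, v ≠ 0 → 0 < g x v v) (u v w : E) :
    2 * g x (christoffel g x u v) w =
      fderiv ℝ g x u v w + fderiv ℝ g x v u w - fderiv ℝ g x w u v := by
  have h := ((isInvertible_of_pos hpos).inverse_apply_eq (x := christoffel g x u v)
    (y := (1 / 2 : ℝ) • (fderiv ℝ g x u v + fderiv ℝ g x v u -
      ((fderiv ℝ g x).flip u).flip v))).1 rfl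
  rw [← h]
  simp only [smul_apply, add_apply,
    sub_apply, ContinuousLinearMap.flip_apply, smul_eq_mul]
  ring

lemma hasFDerivAt_apply_apply {g : E → E →L[ℝ] E →L[ℝ] ℝ} {x : E}
    (hg : DifferentiableAt ℝ g x) (v w : E) :
    HasFDerivAt (fun y => g y v w) (fderiv ℝ (fun y => g y v w) x) x :=
  ((hg.clm_apply (differentiableAt_const v)).clm_apply (differentiableAt_const w)).hasFDerivAt

lemma fderiv_apply_apply {g : E → E →L[ℝ] E →L[ℝ] ℝ} {x : E} (hg : DifferentiableAt ℝ g x)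
    (u v w : E) : fderiv ℝ (fun y => g y v w) x u = fderiv ℝ g x u v w := by
  have h := (hg.hasFDerivAt.clm_apply (hasFDerivAt_const v x)).clm_apply (hasFDerivAt_const w x)
  rw [h.fderiv]
  simp

lemma IsRiemannianMetricOn.differentiableAt {g : E → E →L[ℝ] E →L[ℝ] ℝ} {U : Set E}
    (hg : IsRiemannianMetricOn g U) {x : E} (hx : x ∈ U) : DifferentiableAt ℝ g x :=
  (hg.smooth.contDiffAt (hg.isOpen.mem_nhds hx)).differentiableAt (by simp)

set_option maxSynthPendingDepth 3 in
lemma IsRiemannianMetricOn.differentiableAt_christoffel [FiniteDimensional ℝ E]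
    {g : E → E →L[ℝ] E →L[ℝ] ℝ} {U : Set E} (hg : IsRiemannianMetricOn g U) {x : E} (hx : x ∈ U)
    (v w : E) : DifferentiableAt ℝ (fun y => christoffel g y v w) x := by
  have hgx := hg.smooth.contDiffAt (hg.isOpen.mem_nhds hx)
  have hinv : DifferentiableAt ℝ (fun y => (g y).inverse) x :=
    (((isInvertible_of_pos (hg.pos x hx)).contDiffAt_map_inverse (n := ∞)).comp x
      hgx).differentiableAt (by simp)
  have hd : ContDiffOn ℝ ∞ (fderiv ℝ g) U := hg.smooth.fderiv_of_isOpen hg.isOpen (by simp)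
  have happ : ∀ a b, ContDiffOn ℝ ∞ (fun y => fderiv ℝ g y a b) U := fun a b =>
    (hd.clm_apply contDiffOn_const).clm_apply contDiffOn_const
  have hflip : ContDiffOn ℝ ∞ (fun y => ((fderiv ℝ g y).flip v).flip w) U :=
    contDiffOn_clm_apply.2 fun z => (happ z v).clm_apply contDiffOn_const
  exact hinv.clm_apply ((((((happ v w).add (happ w v)).sub hflip).contDiffAt
    (hg.isOpen.mem_nhds hx)).differentiableAt (by simp)).const_smul (1 / 2 : ℝ))

/-! ### The curvature only depends on the germ of the metric -/

lemma christoffel_congr {g h : E → E →L[ℝ] E →L[ℝ] ℝ} {x : E} (hgh : g =ᶠ[nhds x] h) :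
    ∀ᶠ y in nhds x, christoffel g y = christoffel h y := by
  filter_upwards [hgh.eventuallyEq_nhds] with y hy
  funext u v
  simp only [christoffel, hy.fderiv_eq, hy.eq_of_nhds]

lemma riemann_congr {g h : E → E →L[ℝ] E →L[ℝ] ℝ} {x : E} (hgh : g =ᶠ[nhds x] h) :
    riemann g x = riemann h x := by
  have hc := christoffel_congr hgh
  funext u v w
  have h1 : ∀ a b, (fun y => christoffel g y a b) =ᶠ[nhds x] fun y => christoffel h y a b :=
    fun a b => hc.mono fun y hy => congrFun (congrFun hy a) b
  simp only [riemann, (h1 _ _).fderiv_eq, hc.self_of_nhds]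

/-- The curvature form `g (R(u, v) v, u)`, the numerator of the sectional curvature. -/
def curvForm (g : E → E →L[ℝ] E →L[ℝ] ℝ) (x u v : E) : ℝ := g x (riemann g x u v v) u

lemma curvForm_congr {g h : E → E →L[ℝ] E →L[ℝ] ℝ} {x : E} (hgh : g =ᶠ[nhds x] h) :
    curvForm g x = curvForm h x := by
  funext u v
  simp only [curvForm, riemann_congr hgh, hgh.eq_of_nhds]

/-- The squared area `B (u, u) B (v, v) - B (u, v)²`, as a function of the two vectors. -/
def area (B : E →L[ℝ] E →L[ℝ] ℝ) (u v : E) : ℝ := B u u * B v v - B u v ^ 2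

/-- For a vector `X` and `ξ = B (X, ·)`, the form
`ξ(u)² B (v, v) + ξ(v)² B (u, u) - 2 ξ(u) ξ(v) B (u, v)`: up to the factor `B (X, X)`, the part of
`area B` in the planes that contain `X`. -/
def radialArea (B : E →L[ℝ] E →L[ℝ] ℝ) (X u v : E) : ℝ :=
  B X u ^ 2 * B v v + B X v ^ 2 * B u u - 2 * (B X u * B X v * B u v)

lemma area_self (B : E →L[ℝ] E →L[ℝ] ℝ)
    (u : E) : area B u u = 0 := by
  rw [area]
  ring

lemma radialArea_self (B : E →L[ℝ] E →L[ℝ] ℝ) (X u : E) : radialArea B X u u = 0 := by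
  rw [radialArea]
  ring

lemma sectional_eq (g : E → E →L[ℝ] E →L[ℝ] ℝ) (x u v : E) :
    sectional g x u v = curvForm g x u v / area (g x) u v := rfl

/-! ### Orthonormal frames -/

lemma exists_isFrame [FiniteDimensional ℝ E] {g : E → E →L[ℝ] E →L[ℝ] ℝ} {x : E}
    (hsymm : ∀ u v, g x u v = g x v u) (hpos : ∀ v, v ≠ 0 → 0 < g x v v) :
    ∃ e, IsFrame g x e := by
  let B : LinearMap.BilinForm ℝ E := (ContinuousLinearMap.coeLM ℝ).comp (g x).toLinearMap
  obtain ⟨v, hv⟩ := LinearMap.BilinForm.exists_orthogonal_basis (B := B) ⟨fun a b => hsymm a b⟩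
  have hvpos : ∀ i, 0 < g x (v i) (v i) := fun i => hpos _ (v.ne_zero i)
  have hne : ∀ i, (√(g x (v i) (v i)))⁻¹ ≠ 0 := fun i => by
    have := Real.sqrt_pos.2 (hvpos i)
    positivity
  refine ⟨v.unitsSMul fun i => Units.mk0 _ (hne i), fun i j => ?_⟩
  simp only [Module.Basis.unitsSMul_apply, Units.smul_mk0, map_smul, smul_apply,
    smul_eq_mul]
  split_ifs with hij
  · subst hij
    have := Real.sqrt_pos.2 (hvpos i)
    field_simp
    rw [Real.sq_sqrt (hvpos i).le]
  · rw [show g x (v i) (v j) = 0 from hv hij]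
    simp

section Frame

variable {g : E → E →L[ℝ] E →L[ℝ] ℝ} {x : E} {e : Module.Basis (Fin (Module.finrank ℝ E)) ℝ E}

lemma IsFrame.repr_eq (he : IsFrame g x e) (v : E) (i) : e.repr v i = g x v (e i) := by
  conv_rhs => rw [← e.sum_repr v, map_sum, sum_apply]
  simp [he _ _]

/-- Parseval's identity. -/
lemma IsFrame.sum_mul (he : IsFrame g x e) (u v : E) :
    ∑ i, g x u (e i) * g x v (e i) = g x u v := by
  conv_rhs => rw [← e.sum_repr v]
  simp [he.repr_eq, mul_comm]

/-- The trace of an endomorphism in an orthonormal frame. -/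
lemma IsFrame.sum_apply (he : IsFrame g x e) (f : E →ₗ[ℝ] E) :
    ∑ i, g x (f (e i)) (e i) = LinearMap.trace ℝ E f := by
  rw [LinearMap.trace_eq_matrix_trace ℝ e]
  simp [Matrix.trace, LinearMap.toMatrix_apply, he.repr_eq]

variable {W : Type*} [NormedAddCommGroup W] [NormedSpace ℝ W]
  {B : W →L[ℝ] W →L[ℝ] ℝ} {pr : E →ₗ[ℝ] W} {inc : W →ₗ[ℝ] E}

/-- For an orthogonal summand `W` of the tangent space, with inclusion `inc` and orthogonal
projection `pr`, the trace of the metric of `W` is its dimension. -/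
lemma IsFrame.sum_summand [FiniteDimensional ℝ E] [FiniteDimensional ℝ W] (he : IsFrame g x e)
    (hpr : ∀ w, pr (inc w) = w) (hB : ∀ v w, g x (inc w) v = B w (pr v)) :
    ∑ i, B (pr (e i)) (pr (e i)) = Module.finrank ℝ W := by
  have h := he.sum_apply (inc ∘ₗ pr)
  rw [LinearMap.trace_comp_comm', show pr ∘ₗ inc = LinearMap.id from LinearMap.ext hpr,
    LinearMap.trace_id] at h
  rw [← h]
  exact Finset.sum_congr rfl fun i _ => (hB _ _).symm

lemma IsFrame.sum_mul_summand (he : IsFrame g x e)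
    (hpr : ∀ w, pr (inc w) = w) (hB : ∀ v w, g x (inc w) v = B w (pr v)) (w z : W) :
    ∑ i, B w (pr (e i)) * B z (pr (e i)) = B w z := by
  have h := he.sum_mul (inc w) (inc z)
  rw [hB, hpr] at h
  rw [← h]
  exact Finset.sum_congr rfl fun i _ => by rw [hB, hB]

/-- Twice the sum of the squared areas, in an orthogonal summand, of the planes of a frame: with
`M` the matrix of the projection, it is `(tr M)² - tr M²`, and `M² = M`. -/
lemma IsFrame.sum_area [FiniteDimensional ℝ E] [FiniteDimensional ℝ W] (he : IsFrame g x e)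
    (hpr : ∀ w, pr (inc w) = w) (hB : ∀ v w, g x (inc w) v = B w (pr v)) :
    ∑ i, ∑ j, area B (pr (e i)) (pr (e j)) =
      Module.finrank ℝ W * (Module.finrank ℝ W - 1) := by
  have h1 := he.sum_summand hpr hB
  have h2 := fun i => he.sum_mul_summand hpr hB (pr (e i)) (pr (e i))
  simp only [area, Finset.sum_sub_distrib, sq, h2, ← Finset.mul_sum, ← Finset.sum_mul, h1]
  ring

lemma IsFrame.sum_radialArea [FiniteDimensional ℝ E] [FiniteDimensional ℝ W] (he : IsFrame g x e)
    (hpr : ∀ w, pr (inc w) = w) (hB : ∀ v w, g x (inc w) v = B w (pr v)) (X : W) :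
    ∑ i, ∑ j, radialArea B X (pr (e i)) (pr (e j)) =
      2 * (Module.finrank ℝ W - 1) * B X X := by
  have h1 := he.sum_summand hpr hB
  have h2 := he.sum_mul_summand hpr hB
  have h3 : ∑ i, ∑ j, B X (pr (e i)) * B X (pr (e j)) * B (pr (e i)) (pr (e j)) = B X X := by
    rw [← h2 X X]
    refine Finset.sum_congr rfl fun i _ => ?_
    simp only [mul_assoc, ← Finset.mul_sum, h2]
  simp only [radialArea, Finset.sum_sub_distrib, Finset.sum_add_distrib, sq, ← Finset.mul_sum,
    ← Finset.sum_mul, h1, h2, h3]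
  ring

end Frame

/-- Diagonal terms may be included in the sum that defines the curvature, and the denominators of the
other sectional curvatures are `1` in an orthonormal frame. -/
lemma hasCurvature_of_sum [FiniteDimensional ℝ E] {g : E → E →L[ℝ] E →L[ℝ] ℝ} {x : E} {c : ℝ}
    (hsymm : ∀ u v, g x u v = g x v u) (hpos : ∀ v, v ≠ 0 → 0 < g x v v)
    (hself : ∀ u, curvForm g x u u = 0)
    (hsum : ∀ e, IsFrame g x e → ∑ i, ∑ j, curvForm g x (e i) (e j) = c) :
    HasCurvature g x c := by
  refine ⟨exists_isFrame hsymm hpos, fun e he => ?_⟩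
  rw [← hsum e he]
  refine Finset.sum_congr rfl fun i _ => ?_
  rw [Finset.sum_filter]
  refine Finset.sum_congr rfl fun j _ => ?_
  split_ifs with hij
  · simp [sectional_eq, area, he _ _, hij.symm]
  · rw [not_not.1 hij, hself]

/-- Points with the same sectional curvature have the same curvature. -/
lemma SameSectional.hasCurvature_unique {g : E → E →L[ℝ] E →L[ℝ] ℝ} {x y : E} {a b : ℝ}
    (h : SameSectional g x y) (hx : HasCurvature g x a) (hy : HasCurvature g y b) : a = b := by
  obtain ⟨L, hL, hs⟩ := h
  obtain ⟨⟨e, he⟩, hx⟩ := hx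
  have he' : IsFrame g y (e.map L) := fun i j => by simp [hL, he i j]
  rw [← hx e he, ← hy.2 _ he']
  refine Finset.sum_congr rfl fun i _ => Finset.sum_congr rfl fun j hj => ?_
  simp only [Module.Basis.map_apply]
  refine (hs _ _ ?_).symm
  have hij : i ≠ j := fun h => (Finset.mem_filter.1 hj).2 h.symm
  have := e.linearIndependent.comp ![i, j] (by
    intro a b; fin_cases a <;> fin_cases b <;> simp [hij, hij.symm])
  convert this using 1
  ext k
  fin_cases k <;> rfl

lemma sameSectional_of_curvForm {g : E → E →L[ℝ] E →L[ℝ] ℝ} {x y : E} (L : E ≃ₗ[ℝ] E)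
    (hL : ∀ u v, g y (L u) (L v) = g x u v)
    (hc : ∀ u v, curvForm g y (L u) (L v) = curvForm g x u v) : SameSectional g x y :=
  ⟨L, hL, fun u v _ => by simp only [sectional_eq, area, hc, hL]⟩

/-- Any two inner products on a vector space are isometric. -/
lemma exists_isometry [FiniteDimensional ℝ E] {g : E → E →L[ℝ] E →L[ℝ] ℝ} {x y : E}
    (hx : ∀ u v, g x u v = g x v u) (hxpos : ∀ v, v ≠ 0 → 0 < g x v v)
    (hy : ∀ u v, g y u v = g y v u) (hypos : ∀ v, v ≠ 0 → 0 < g y v v) :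
    ∃ L : E ≃ₗ[ℝ] E, ∀ u v, g y (L u) (L v) = g x u v := by
  obtain ⟨e, he⟩ := exists_isFrame hx hxpos
  obtain ⟨f, hf⟩ := exists_isFrame hy hypos
  refine ⟨e.equiv f (Equiv.refl _), fun u v => ?_⟩
  rw [← he.sum_mul, ← hf.sum_mul]
  refine Finset.sum_congr rfl fun i _ => ?_
  rw [← he.repr_eq, ← he.repr_eq, ← hf.repr_eq, ← hf.repr_eq]
  simp [Module.Basis.equiv]

/-! ### Products -/

section Prod

variable {E F : Type*} [NormedAddCommGroup E] [NormedSpace ℝ E] [NormedAddCommGroup F]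
  [NormedSpace ℝ F] {g : E → E →L[ℝ] E →L[ℝ] ℝ} {h : F → F →L[ℝ] F →L[ℝ] ℝ} {U : Set E} {W : Set F}

@[simp] lemma prodMetric_apply (x u v : E × F) :
    prodMetric g h x u v = g x.1 u.1 v.1 + h x.2 u.2 v.2 := rfl

lemma IsRiemannianMetricOn.prod [FiniteDimensional ℝ E] [FiniteDimensional ℝ F]
    (hg : IsRiemannianMetricOn g U) (hh : IsRiemannianMetricOn h W) :
    IsRiemannianMetricOn (prodMetric g h) (U ×ˢ W) where
  isOpen := hg.isOpen.prod hh.isOpen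
  smooth := by
    refine contDiffOn_clm_apply.2 fun u => contDiffOn_clm_apply.2 fun v => ?_
    simp only [prodMetric_apply]
    have h1 := hg.smooth.comp (contDiff_fst (E := E) (F := F)).contDiffOn
      (s := U ×ˢ W) fun x hx => hx.1
    have h2 := hh.smooth.comp (contDiff_snd (E := E) (F := F)).contDiffOn
      (s := U ×ˢ W) fun x hx => hx.2
    exact ((h1.clm_apply contDiffOn_const).clm_apply contDiffOn_const).add
      ((h2.clm_apply contDiffOn_const).clm_apply contDiffOn_const)
  symm x hx u v := by simp [hg.symm _ hx.1 u.1, hh.symm _ hx.2 u.2]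
  pos x hx v hv := by
    rw [prodMetric_apply]
    rcases eq_or_ne v.1 0 with h1 | h1
    · have h2 : v.2 ≠ 0 := fun h2 => hv (Prod.ext h1 h2)
      simpa [h1] using hh.pos _ hx.2 _ h2
    · rcases eq_or_ne v.2 0 with h2 | h2
      · simpa [h2] using hg.pos _ hx.1 _ h1
      · exact add_pos (hg.pos _ hx.1 _ h1) (hh.pos _ hx.2 _ h2)

variable [FiniteDimensional ℝ E] [FiniteDimensional ℝ F]

lemma christoffel_prod (hg : IsRiemannianMetricOn g U) (hh : IsRiemannianMetricOn h W)
    {x : E × F} (hx : x ∈ U ×ˢ W) (u v : E × F) :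
    christoffel (prodMetric g h) x u v = (christoffel g x.1 u.1 v.1, christoffel h x.2 u.2 v.2) := by
  have hp := hg.prod hh
  have hd : ∀ u v w : E × F, fderiv ℝ (prodMetric g h) x u v w =
      fderiv ℝ g x.1 u.1 v.1 w.1 + fderiv ℝ h x.2 u.2 v.2 w.2 := by
    intro u v w
    rw [← fderiv_apply_apply (hp.differentiableAt hx)]
    simp only [prodMetric_apply]
    have h1 := (hasFDerivAt_apply_apply (hg.differentiableAt hx.1) v.1 w.1).comp x
      (hasFDerivAt_fst (𝕜 := ℝ))
    have h2 := (hasFDerivAt_apply_apply (hh.differentiableAt hx.2) v.2 w.2).comp x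
      (hasFDerivAt_snd (𝕜 := ℝ))
    erw [(h1.add h2).fderiv]
    simp [fderiv_apply_apply, hg.differentiableAt hx.1, hh.differentiableAt hx.2]
  refine christoffel_eq (hp.pos x hx) fun w => ?_
  simp only [hd, prodMetric_apply, mul_add, koszul (hg.pos _ hx.1), koszul (hh.pos _ hx.2)]
  ring

lemma riemann_prod (hg : IsRiemannianMetricOn g U) (hh : IsRiemannianMetricOn h W)
    {x : E × F} (hx : x ∈ U ×ˢ W) (u v w : E × F) :
    riemann (prodMetric g h) x u v w =
      (riemann g x.1 u.1 v.1 w.1, riemann h x.2 u.2 v.2 w.2) := by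
  have hd : ∀ u v w : E × F, fderiv ℝ (fun y => christoffel (prodMetric g h) y v w) x u =
      (fderiv ℝ (fun y => christoffel g y v.1 w.1) x.1 u.1,
        fderiv ℝ (fun y => christoffel h y v.2 w.2) x.2 u.2) := by
    intro u v w
    have heq : (fun y => christoffel (prodMetric g h) y v w) =ᶠ[nhds x]
        fun y => (christoffel g y.1 v.1 w.1, christoffel h y.2 v.2 w.2) :=
      ((hg.prod hh).isOpen.mem_nhds hx |> Filter.eventually_of_mem) fun y hy =>
        christoffel_prod hg hh hy v w
    rw [heq.fderiv_eq]
    have h1 := (hg.differentiableAt_christoffel hx.1 v.1 w.1).hasFDerivAt.comp x hasFDerivAt_fst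
    have h2 := (hh.differentiableAt_christoffel hx.2 v.2 w.2).hasFDerivAt.comp x hasFDerivAt_snd
    erw [(h1.prodMk h2).fderiv]
    simp
  simp only [riemann, hd, christoffel_prod hg hh hx]
  rfl

lemma curvForm_prod (hg : IsRiemannianMetricOn g U) (hh : IsRiemannianMetricOn h W)
    {x : E × F} (hx : x ∈ U ×ˢ W) (u v : E × F) :
    curvForm (prodMetric g h) x u v = curvForm g x.1 u.1 v.1 + curvForm h x.2 u.2 v.2 := by
  rw [curvForm, riemann_prod hg hh hx, prodMetric_apply]
  rfl

end Prod

section Pi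

variable {ι : Type*} [Fintype ι] {V : ι → Type*} [∀ i, NormedAddCommGroup (V i)]
  [∀ i, NormedSpace ℝ (V i)] {g : ∀ i, V i → V i →L[ℝ] V i →L[ℝ] ℝ} {U : ∀ i, Set (V i)}

@[simp] lemma piMetric_apply (x u v : ∀ i, V i) :
    piMetric g x u v = ∑ i, g i (x i) (u i) (v i) := by
  simp [piMetric]

lemma IsRiemannianMetricOn.pi [∀ i, FiniteDimensional ℝ (V i)]
    (hg : ∀ i, IsRiemannianMetricOn (g i) (U i)) :
    IsRiemannianMetricOn (piMetric g) {x | ∀ i, x i ∈ U i} where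
  isOpen := by
    simpa [Set.pi, Set.mem_univ] using isOpen_set_pi Set.finite_univ fun i _ => (hg i).isOpen
  smooth := by
    refine contDiffOn_clm_apply.2 fun u => contDiffOn_clm_apply.2 fun v => ?_
    simp only [piMetric_apply]
    refine ContDiffOn.sum fun i _ => ?_
    have h1 := (hg i).smooth.comp (ContinuousLinearMap.proj (R := ℝ) (φ := V) i).contDiff.contDiffOn
      (s := {x | ∀ i, x i ∈ U i}) fun x hx => hx i
    exact (h1.clm_apply contDiffOn_const).clm_apply contDiffOn_const
  symm x hx u v := by
    simp only [piMetric_apply]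
    exact Finset.sum_congr rfl fun i _ => (hg i).symm _ (hx i) _ _
  pos x hx v hv := by
    rw [piMetric_apply]
    obtain ⟨i, hi⟩ := Function.ne_iff.1 hv
    refine Finset.sum_pos' (fun j _ => ?_) ⟨i, Finset.mem_univ i, (hg i).pos _ (hx i) _ hi⟩
    rcases eq_or_ne (v j) 0 with h | h
    · simp [h]
    · exact ((hg j).pos _ (hx j) _ h).le

variable [∀ i, FiniteDimensional ℝ (V i)]

lemma christoffel_pi (hg : ∀ i, IsRiemannianMetricOn (g i) (U i)) {x : ∀ i, V i}
    (hx : ∀ i, x i ∈ U i) (u v : ∀ i, V i) :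
    christoffel (piMetric g) x u v = fun i => christoffel (g i) (x i) (u i) (v i) := by
  have hp := IsRiemannianMetricOn.pi hg
  have hd : ∀ u v w : ∀ i, V i, fderiv ℝ (piMetric g) x u v w =
      ∑ i, fderiv ℝ (g i) (x i) (u i) (v i) (w i) := by
    intro u v w
    rw [← fderiv_apply_apply (hp.differentiableAt hx)]
    simp only [piMetric_apply]
    have h1 := fun i => (hasFDerivAt_apply_apply ((hg i).differentiableAt (hx i))
      (v i) (w i)).comp x (hasFDerivAt_apply (𝕜 := ℝ) i x)
    erw [(HasFDerivAt.fun_sum fun i _ => h1 i).fderiv]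
    simp [fderiv_apply_apply, fun i => (hg i).differentiableAt (hx i)]
  refine christoffel_eq (hp.pos x hx) fun w => ?_
  simp only [hd, piMetric_apply, Finset.mul_sum, koszul ((hg _).pos _ (hx _)),
    Finset.sum_add_distrib, Finset.sum_sub_distrib]

lemma riemann_pi (hg : ∀ i, IsRiemannianMetricOn (g i) (U i)) {x : ∀ i, V i}
    (hx : ∀ i, x i ∈ U i) (u v w : ∀ i, V i) :
    riemann (piMetric g) x u v w = fun i => riemann (g i) (x i) (u i) (v i) (w i) := by
  have hd : ∀ u v w : ∀ i, V i, fderiv ℝ (fun y => christoffel (piMetric g) y v w) x u =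
      fun i => fderiv ℝ (fun y => christoffel (g i) y (v i) (w i)) (x i) (u i) := by
    intro u v w
    have heq : (fun y => christoffel (piMetric g) y v w) =ᶠ[nhds x]
        fun y i => christoffel (g i) (y i) (v i) (w i) :=
      ((IsRiemannianMetricOn.pi hg).isOpen.mem_nhds hx |> Filter.eventually_of_mem) fun y hy =>
        christoffel_pi hg hy v w
    rw [heq.fderiv_eq]
    have h1 := fun i => ((hg i).differentiableAt_christoffel (hx i) (v i) (w i)).hasFDerivAt.comp x
      (hasFDerivAt_apply (𝕜 := ℝ) i x)
    erw [(hasFDerivAt_pi.2 h1).fderiv]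
    rfl
  simp only [riemann, hd, christoffel_pi hg hx]
  rfl

lemma curvForm_pi (hg : ∀ i, IsRiemannianMetricOn (g i) (U i)) {x : ∀ i, V i}
    (hx : ∀ i, x i ∈ U i) (u v : ∀ i, V i) :
    curvForm (piMetric g) x u v = ∑ i, curvForm (g i) (x i) (u i) (v i) := by
  rw [curvForm, riemann_pi hg hx, piMetric_apply]
  rfl

end Pi

/-! ### Rotationally invariant Christoffel maps -/

section Rotational

variable {E : Type*} [NormedAddCommGroup E] [InnerProductSpace ℝ E]

local notation "⟪" x ", " y "⟫" => inner ℝ x y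

/-- A rotationally invariant Christoffel map with coefficients `p`, `q`, `s`. -/
def radialChristoffel (p q s : ℝ) (x u v : E) : E :=
  p • (⟪x, u⟫ • v + ⟪x, v⟫ • u) + (q * ⟪x, u⟫ * ⟪x, v⟫ + s * ⟪u, v⟫) • x

/-- The curvature of a connection whose Christoffel map is rotationally invariant, when the
gradients of the coefficients `p` and `s` at `x` are `p' x` and `s' x`. -/
lemma riemann_of_radialChristoffel {g : E → E →L[ℝ] E →L[ℝ] ℝ} {x : E} {p q s : E → ℝ}
    {p' q' s' : ℝ} (hΓ : ∀ᶠ y in nhds x, ∀ u v, christoffel g y u v =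
      radialChristoffel (p y) (q y) (s y) y u v)
    (hp : HasFDerivAt p (p' • innerSL ℝ x) x) (hs : HasFDerivAt s (s' • innerSL ℝ x) x)
    (hq : HasFDerivAt q (q' • innerSL ℝ x) x) (u v w : E) :
    riemann g x u v w =
      (s x - p x + p x * s x * ⟪x, x⟫) • (⟪v, w⟫ • u - ⟪u, w⟫ • v) +
      ((q x - p' + p x ^ 2 + p x * q x * ⟪x, x⟫) * ⟪x, w⟫) • (⟪x, v⟫ • u - ⟪x, u⟫ • v) +
      ((s' - q x + s x ^ 2 + s x * q x * ⟪x, x⟫) * (⟪x, u⟫ * ⟪v, w⟫ - ⟪x, v⟫ * ⟪u, w⟫)) • x := by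
  have hi : ∀ v : E, HasFDerivAt (fun y : E => ⟪y, v⟫) (innerSL ℝ v) x := fun v => by
    have := (innerSL ℝ v).hasFDerivAt (x := x)
    simpa [real_inner_comm] using this
  have hd : ∀ u v w : E, fderiv ℝ (fun y => christoffel g y v w) x u =
      (p' * ⟪x, u⟫) • (⟪x, v⟫ • w + ⟪x, w⟫ • v) + p x • (⟪u, v⟫ • w + ⟪u, w⟫ • v) +
      (q' * ⟪x, u⟫ * ⟪x, v⟫ * ⟪x, w⟫ + q x * (⟪u, v⟫ * ⟪x, w⟫ + ⟪x, v⟫ * ⟪u, w⟫) +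
        s' * ⟪x, u⟫ * ⟪v, w⟫) • x + (q x * ⟪x, v⟫ * ⟪x, w⟫ + s x * ⟪v, w⟫) • u := by
    intro u v w
    have heq : (fun y => christoffel g y v w) =ᶠ[nhds x]
        fun y => radialChristoffel (p y) (q y) (s y) y v w := hΓ.mono fun y hy => hy v w
    rw [heq.fderiv_eq]
    have h1 := hp.smul (((hi v).smul_const w).add ((hi w).smul_const v))
    have h2 := (((hq.mul (hi v)).mul (hi w)).add (hs.mul_const ⟪v, w⟫)).smul (hasFDerivAt_id x)
    erw [(h1.add h2).fderiv]
    simp only [add_apply, smul_apply, ContinuousLinearMap.smulRight_apply, innerSL_apply_apply,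
      smul_eq_mul, ContinuousLinearMap.id_apply, real_inner_comm u v, real_inner_comm u w, id,
      Pi.mul_apply, Pi.add_apply]
    module
  simp only [riemann, hd, hΓ.self_of_nhds, radialChristoffel, inner_add_right, inner_smul_right,
    real_inner_comm v u, real_inner_comm x u, real_inner_comm x v]
  module

end Rotational

local notation "⟪" x ", " y "⟫" => inner ℝ x y

/-! ### The stereographic models -/

section Stereo

variable {κ : ℝ} {d : ℕ}

/-- The conformal factor of the `κ`-stereographic model. -/
def confFactor (κ : ℝ) {d : ℕ} (x : EuclideanSpace ℝ (Fin d)) : ℝ := 2 / (1 + κ * ‖x‖ ^ 2)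

lemma stereoMetric_apply (x u v : EuclideanSpace ℝ (Fin d)) :
    stereoMetric κ d x u v = confFactor κ x ^ 2 * ⟪u, v⟫ := rfl

lemma one_add_pos_of_mem_stereo {x : EuclideanSpace ℝ (Fin d)} (hx : x ∈ stereo κ d) :
    0 < 1 + κ * ‖x‖ ^ 2 := by
  have : -κ * ‖x‖ ^ 2 < 1 := hx
  linarith

lemma confFactor_pos {x : EuclideanSpace ℝ (Fin d)} (hx : x ∈ stereo κ d) :
    0 < confFactor κ x := div_pos two_pos (one_add_pos_of_mem_stereo hx)

lemma confFactor_mul {x : EuclideanSpace ℝ (Fin d)} (hx : x ∈ stereo κ d) :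
    confFactor κ x * (1 + κ * ⟪x, x⟫) = 2 := by
  rw [confFactor, real_inner_self_eq_norm_sq]
  exact div_mul_cancel₀ _ (one_add_pos_of_mem_stereo hx).ne'

lemma hasFDerivAt_confFactor {x : EuclideanSpace ℝ (Fin d)} (hx : x ∈ stereo κ d) :
    HasFDerivAt (confFactor κ) ((-κ * confFactor κ x ^ 2) • innerSL ℝ x) x := by
  have h := (one_add_pos_of_mem_stereo hx).ne'
  have h1 := ((hasStrictFDerivAt_norm_sq x).hasFDerivAt.const_mul κ).const_add 1
  have h2 := ((hasDerivAt_inv h).comp_hasFDerivAt x h1).const_mul 2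
  refine (h2.congr_fderiv ?_).congr_of_eventuallyEq (.of_forall fun y => ?_)
  · ext y
    simp [confFactor]
    field_simp
  · simp [confFactor, div_eq_mul_inv]

lemma isRiemannianMetricOn_stereo (κ : ℝ) (d : ℕ) :
    IsRiemannianMetricOn (stereoMetric κ d) (stereo κ d) where
  isOpen := isOpen_lt (by fun_prop) continuous_const
  smooth := by
    refine contDiffOn_clm_apply.2 fun u => contDiffOn_clm_apply.2 fun v => ?_
    simp only [stereoMetric_apply, confFactor]
    refine ContDiffOn.mul (ContDiffOn.pow (ContDiffOn.div contDiffOn_const ?_ fun x hx =>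
      (one_add_pos_of_mem_stereo hx).ne') 2) contDiffOn_const
    exact (contDiff_const.add (contDiff_const.mul (contDiff_norm_sq ℝ))).contDiffOn
  symm x _ u v := by simp only [stereoMetric_apply, real_inner_comm]
  pos x hx v hv := by
    rw [stereoMetric_apply]
    exact mul_pos (pow_pos (confFactor_pos hx) 2) (real_inner_self_pos.2 hv)

lemma christoffel_stereo {x : EuclideanSpace ℝ (Fin d)} (hx : x ∈ stereo κ d)
    (u v : EuclideanSpace ℝ (Fin d)) : christoffel (stereoMetric κ d) x u v =
      radialChristoffel (-κ * confFactor κ x) 0 (κ * confFactor κ x) x u v := by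
  have hg := isRiemannianMetricOn_stereo κ d
  have hd : ∀ u v w, fderiv ℝ (stereoMetric κ d) x u v w =
      -2 * κ * confFactor κ x ^ 3 * ⟪x, u⟫ * ⟪v, w⟫ := by
    intro u v w
    rw [← fderiv_apply_apply (hg.differentiableAt hx)]
    simp only [stereoMetric_apply]
    rw [(((hasFDerivAt_confFactor hx).pow 2).mul_const ⟪v, w⟫).fderiv]
    simp
    ring
  refine christoffel_eq (hg.pos x hx) fun w => ?_
  simp only [hd, stereoMetric_apply, radialChristoffel, inner_add_left, inner_smul_left,
    real_inner_comm w x, RCLike.conj_to_real]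
  ring

/-- The `κ`-stereographic model has constant sectional curvature `κ`. -/
lemma curvForm_stereo {x : EuclideanSpace ℝ (Fin d)} (hx : x ∈ stereo κ d)
    (u v : EuclideanSpace ℝ (Fin d)) :
    curvForm (stereoMetric κ d) x u v = κ * area (stereoMetric κ d x) u v := by
  have hg := isRiemannianMetricOn_stereo κ d
  have hl := hasFDerivAt_confFactor hx
  rw [curvForm, riemann_of_radialChristoffel (p := fun x => -κ * confFactor κ x) (q := fun _ => 0)
    (s := fun x => κ * confFactor κ x) (p' := -κ * (-κ * confFactor κ x ^ 2)) (q' := 0)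
    (s' := κ * (-κ * confFactor κ x ^ 2))
    (Filter.eventually_of_mem (hg.isOpen.mem_nhds hx) fun y hy => christoffel_stereo hy)
    ((hl.const_mul _).congr_fderiv (smul_smul _ _ _))
    ((hl.const_mul _).congr_fderiv (smul_smul _ _ _))
    ((hasFDerivAt_const _ _).congr_fderiv (zero_smul ℝ _).symm)]
  simp only [stereoMetric_apply, area, inner_add_left, inner_sub_left, inner_smul_left,
    RCLike.conj_to_real, real_inner_comm u v]
  linear_combination (-κ * confFactor κ x ^ 3 * (⟪u, u⟫ * ⟪v, v⟫ - ⟪u, v⟫ ^ 2)) *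
    confFactor_mul hx

end Stereo

/-! ### Metrics with radial coefficients -/

section Rot

variable {E : Type*} [NormedAddCommGroup E] [InnerProductSpace ℝ E]

variable (E) in
/-- The inner product of `E` as a real bilinear form. -/
def innerForm : E →L[ℝ] E →L[ℝ] ℝ := innerSL ℝ

/-- The metric `a(|x|)² ⟨·, ·⟩ + b(|x|) ⟨x, ·⟩ ⟨x, ·⟩`. -/
def radialMetric (a b : ℝ → ℝ) (x : E) : E →L[ℝ] E →L[ℝ] ℝ :=
  a ‖x‖ ^ 2 • innerForm E + b ‖x‖ • (innerForm E x).smulRight (innerForm E x)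

lemma radialMetric_apply (a b : ℝ → ℝ) (x u v : E) :
    radialMetric a b x u v = a ‖x‖ ^ 2 * ⟪u, v⟫ + b ‖x‖ * (⟪x, u⟫ * ⟪x, v⟫) := rfl

/-- The coefficients of a metric `a(|x|)² ⟨·, ·⟩ + b(|x|) ⟨x, ·⟩ ⟨x, ·⟩` in geodesic polar
coordinates: smooth even functions such that the radial vector `x` has length `|x|`. -/
structure IsPolar (a b : ℝ → ℝ) : Prop where
  smooth_left : ContDiff ℝ ∞ a
  smooth_right : ContDiff ℝ ∞ b
  even_left : a.Even
  even_right : b.Even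
  radial : ∀ r, b r * r ^ 2 + a r ^ 2 = 1

variable {a b : ℝ → ℝ}

/-- The derivative of `b r² + a² = 1`, divided by `r`; at `r = 0` it holds by continuity. -/
lemma IsPolar.radial_deriv (h : IsPolar a b) (r : ℝ) :
    radialDeriv b r * r ^ 2 + 2 * b r + 2 * a r * radialDeriv a r = 0 := by
  have hda : ∀ r, HasDerivAt a (r * radialDeriv a r) r := fun r => by
    rw [mul_radialDeriv h.even_left]
    exact (h.smooth_left.differentiable (by simp) r).hasDerivAt
  have hdb : ∀ r, HasDerivAt b (r * radialDeriv b r) r := fun r => by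
    rw [mul_radialDeriv h.even_right]
    exact (h.smooth_right.differentiable (by simp) r).hasDerivAt
  have key : ∀ r, r * (radialDeriv b r * r ^ 2 + 2 * b r + 2 * a r * radialDeriv a r) = 0 := by
    intro r
    have h1 := ((hdb r).mul (hasDerivAt_pow 2 r)).add ((hda r).pow 2)
    have h2 : HasDerivAt (fun r => b r * r ^ 2 + a r ^ 2) 0 r := by
      simp only [h.radial]
      exact hasDerivAt_const r 1
    have := h1.unique h2
    simp at this
    linear_combination this
  have hc : Continuous fun r => radialDeriv b r * r ^ 2 + 2 * b r + 2 * a r * radialDeriv a r := by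
    have := (contDiff_radialDeriv h.smooth_left).continuous
    have := (contDiff_radialDeriv h.smooth_right).continuous
    have := h.smooth_left.continuous
    have := h.smooth_right.continuous
    fun_prop
  have := Continuous.ext_on (dense_compl_singleton (0 : ℝ)) hc continuous_const (g := fun _ => 0)
    fun r hr => (mul_eq_zero.1 (key r)).resolve_left hr
  exact congrFun this r

lemma IsPolar.radialMetric_self (h : IsPolar a b) (x u : E) :
    radialMetric a b x x u = ⟪x, u⟫ := by
  rw [radialMetric_apply, real_inner_self_eq_norm_sq]
  linear_combination ⟪x, u⟫ * h.radial ‖x‖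

/-- For `b < 0` the form is bounded below by `(a² + b |x|²) ⟨v, v⟩ = ⟨v, v⟩`, by Cauchy-Schwarz. -/
lemma radialMetric_pos (h : IsPolar a b) {x : E} (hx : a ‖x‖ ≠ 0) {v : E} (hv : v ≠ 0) :
    0 < radialMetric a b x v v := by
  rw [radialMetric_apply]
  have hv' : 0 < ⟪v, v⟫ := real_inner_self_pos.2 hv
  have ha : 0 < a ‖x‖ ^ 2 := by positivity
  rcases le_or_gt 0 (b ‖x‖) with hb | hb
  · exact add_pos_of_pos_of_nonneg (mul_pos ha hv') (mul_nonneg hb (mul_self_nonneg _))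
  · have h1 := real_inner_mul_inner_self_le x v
    rw [real_inner_self_eq_norm_sq x] at h1
    have h2 := mul_le_mul_of_nonpos_left h1 hb.le
    have h3 := h.radial ‖x‖
    nlinarith

variable [FiniteDimensional ℝ E]

lemma contDiff_radialMetric (h : IsPolar a b) :
    ContDiff ℝ ∞ (radialMetric (E := E) a b) := by
  refine contDiff_clm_apply_iff.2 fun u => contDiff_clm_apply_iff.2 fun v => ?_
  simp only [radialMetric_apply]
  have h1 := contDiff_radial (E := E) h.smooth_left h.even_left
  have h2 := contDiff_radial (E := E) h.smooth_right h.even_right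
  have h3 : ∀ v : E, ContDiff ℝ ∞ fun x : E => ⟪x, v⟫ := fun v =>
    contDiff_id.inner ℝ contDiff_const
  exact ((h1.pow 2).mul contDiff_const).add (h2.mul ((h3 u).mul (h3 v)))

lemma christoffel_radialMetric (h : IsPolar a b) {x : E} (hx : a ‖x‖ ≠ 0) (u v : E) :
    christoffel (radialMetric a b) x u v =
      radialChristoffel (radialDeriv a ‖x‖ / a ‖x‖)
        (radialDeriv b ‖x‖ / 2 - 2 * (radialDeriv a ‖x‖ * b ‖x‖ / a ‖x‖))
        (b ‖x‖ - a ‖x‖ * radialDeriv a ‖x‖) x u v := by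
  have hdiff : DifferentiableAt ℝ (radialMetric (E := E) a b) x :=
    (contDiff_radialMetric h).differentiable (by simp) x
  have hi : ∀ v : E, HasFDerivAt (fun y : E => ⟪y, v⟫) (innerSL ℝ v) x := fun v => by
    have := (innerSL ℝ v).hasFDerivAt (x := x)
    simpa [real_inner_comm] using this
  have hd : ∀ u v w, fderiv ℝ (radialMetric a b) x u v w =
      2 * a ‖x‖ * radialDeriv a ‖x‖ * ⟪x, u⟫ * ⟪v, w⟫ +
      radialDeriv b ‖x‖ * ⟪x, u⟫ * ⟪x, v⟫ * ⟪x, w⟫ +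
      b ‖x‖ * (⟪u, v⟫ * ⟪x, w⟫ + ⟪x, v⟫ * ⟪u, w⟫) := by
    intro u v w
    rw [← fderiv_apply_apply hdiff]
    simp only [radialMetric_apply]
    have h1 := ((hasFDerivAt_radial h.smooth_left h.even_left x).pow 2).mul_const ⟪v, w⟫
    have h2 := (hasFDerivAt_radial h.smooth_right h.even_right x).mul ((hi v).mul (hi w))
    erw [(h1.add h2).fderiv]
    simp [real_inner_comm u]
    ring
  refine christoffel_eq (fun v hv => radialMetric_pos h hx hv) fun w => ?_
  rw [radialChristoffel, map_add, add_apply, map_smul _ _ x, smul_apply, h.radialMetric_self]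
  simp only [hd, map_add, map_smul, add_apply, smul_apply, radialMetric_apply, smul_eq_mul,
    real_inner_comm u v, real_inner_comm u w, real_inner_comm v w]
  field_simp
  ring

/-- The tangential sectional curvature of the metric with polar coefficients `a`, `b`. -/
def tanCurv (a b : ℝ → ℝ) (r : ℝ) : ℝ :=
  (b r - 2 * a r * radialDeriv a r - r ^ 2 * radialDeriv a r ^ 2) / a r ^ 2

/-- The difference of the radial and the tangential sectional curvature of the metric with polar
coefficients `a`, `b`, divided by `r²`. -/
def curvDiff (a b : ℝ → ℝ) (r : ℝ) : ℝ :=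
  (radialDeriv b r / 2 - a r * radialDeriv (radialDeriv a) r + radialDeriv a r ^ 2) / a r ^ 2

lemma curvForm_radialMetric (h : IsPolar a b) {x : E} (hx : a ‖x‖ ≠ 0) (u v : E) :
    curvForm (radialMetric a b) x u v =
      tanCurv a b ‖x‖ * area (radialMetric a b x) u v +
      curvDiff a b ‖x‖ * radialArea (radialMetric a b x) x u v := by
  have hev : ∀ᶠ y : E in nhds x, a ‖y‖ ≠ 0 :=
    ((h.smooth_left.continuous.comp continuous_norm).continuousAt (x := x)).eventually_ne hx
  have ha0 := hasFDerivAt_radial h.smooth_left h.even_left x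
  have ha1 := hasFDerivAt_radial (contDiff_radialDeriv h.smooth_left)
    (even_radialDeriv h.even_left) x
  have hb0 := hasFDerivAt_radial h.smooth_right h.even_right x
  have hb1 := hasFDerivAt_radial (contDiff_radialDeriv h.smooth_right)
    (even_radialDeriv h.even_right) x
  have hinv := (hasDerivAt_inv hx).comp_hasFDerivAt x ha0
  set A := a ‖x‖
  set A₁ := radialDeriv a ‖x‖
  set A₂ := radialDeriv (radialDeriv a) ‖x‖
  set B := b ‖x‖
  set B₁ := radialDeriv b ‖x‖
  set B₂ := radialDeriv (radialDeriv b) ‖x‖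
  have hx' : a ‖x‖ ≠ 0 := hx
  have hp : HasFDerivAt (fun y : E => radialDeriv a ‖y‖ / a ‖y‖)
      (((A₂ * A - A₁ ^ 2) / A ^ 2) • innerSL ℝ x) x := by
    refine (ha1.mul hinv).congr_fderiv ?_
    ext y
    simp [A, A₁, A₂]
    field_simp
    ring
  have hq : HasFDerivAt (fun y : E => radialDeriv b ‖y‖ / 2 -
      2 * (radialDeriv a ‖y‖ * b ‖y‖ / a ‖y‖))
      ((B₂ / 2 - 2 * (((A₂ * B + A₁ * B₁) * A - A₁ ^ 2 * B) / A ^ 2)) • innerSL ℝ x) x := by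
    refine ((hb1.mul_const 2⁻¹).sub (((ha1.mul hb0).mul hinv).const_mul 2)).congr_fderiv ?_
    ext y
    simp [A, A₁, A₂, B, B₁, B₂]
    field_simp
    ring
  have hs : HasFDerivAt (fun y : E => b ‖y‖ - a ‖y‖ * radialDeriv a ‖y‖)
      ((B₁ - (A₁ ^ 2 + A * A₂)) • innerSL ℝ x) x := by
    refine (hb0.sub (ha0.mul ha1)).congr_fderiv ?_
    ext y
    simp
    ring
  rw [curvForm, riemann_of_radialChristoffel
    (hev.mono fun y hy => christoffel_radialMetric h hy) hp hs hq]
  have h1 : B * ‖x‖ ^ 2 + A ^ 2 = 1 := h.radial ‖x‖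
  have h2 : B₁ * ‖x‖ ^ 2 + 2 * B + 2 * A * A₁ = 0 := h.radial_deriv ‖x‖
  rw [map_add, map_add, add_apply, add_apply, map_smul, map_smul, map_smul _ _ x, smul_apply,
    smul_apply, smul_apply, h.radialMetric_self, real_inner_self_eq_norm_sq]
  -- the three coefficients in `riemann_of_radialChristoffel` through the two curvature functions
  have c1 : B - A * A₁ - A₁ / A + A₁ / A * (B - A * A₁) * ‖x‖ ^ 2 =
      tanCurv a b ‖x‖ * A ^ 2 := by
    change _ = (B - 2 * A * A₁ - ‖x‖ ^ 2 * A₁ ^ 2) / A ^ 2 * A ^ 2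
    field_simp
    linear_combination A₁ * h1
  have c2 : B₁ / 2 - 2 * (A₁ * B / A) - (A₂ * A - A₁ ^ 2) / A ^ 2 + (A₁ / A) ^ 2 +
      A₁ / A * (B₁ / 2 - 2 * (A₁ * B / A)) * ‖x‖ ^ 2 =
      tanCurv a b ‖x‖ * B + curvDiff a b ‖x‖ := by
    change _ = (B - 2 * A * A₁ - ‖x‖ ^ 2 * A₁ ^ 2) / A ^ 2 * B +
      (B₁ / 2 - A * A₂ + A₁ ^ 2) / A ^ 2
    field_simp
    linear_combination (B₁ - 2 * A₁ ^ 2) * h1 + (A * A₁ - B) * h2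
  have c3 : B₁ - (A₁ ^ 2 + A * A₂) - (B₁ / 2 - 2 * (A₁ * B / A)) + (B - A * A₁) ^ 2 +
      (B - A * A₁) * (B₁ / 2 - 2 * (A₁ * B / A)) * ‖x‖ ^ 2 =
      curvDiff a b ‖x‖ * A ^ 2 := by
    change _ = (B₁ / 2 - A * A₂ + A₁ ^ 2) / A ^ 2 * A ^ 2
    field_simp
    linear_combination (B - A * A₁) * A * h2 - 4 * A₁ * (B - A * A₁) * h1
  rw [c1, c2, c3]
  simp only [area, radialArea, h.radialMetric_self]
  simp only [map_sub, map_smul, sub_apply, smul_apply, radialMetric_apply, smul_eq_mul,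
    real_inner_comm u v]
  ring

end Rot

/-! ### Rotationally symmetric metrics -/

section Profile

variable {ρ : ℝ → ℝ}

/-- The coefficient of `⟨x, ·⟩ ⟨x, ·⟩` in the rotationally symmetric metric with profile `ρ`: it is
`(1 - ρ(r)² / r²) / r²`, completed at `r = 0`. -/
def polarCoeff (ρ : ℝ → ℝ) : ℝ → ℝ := dslope (dslope (fun r => 1 - dslope ρ 0 r ^ 2) 0) 0

lemma isPolar_of_odd (hs : ContDiff ℝ ∞ ρ) (ho : ρ.Odd) (h1 : deriv ρ 0 = 1) :
    IsPolar (dslope ρ 0) (polarCoeff ρ) := by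
  have hσ := contDiff_dslope_zero hs
  have hσe := even_dslope_of_odd ho
  have hf : ContDiff ℝ ∞ fun r => 1 - dslope ρ 0 r ^ 2 := contDiff_const.sub (hσ.pow 2)
  have hfe : Function.Even fun r => 1 - dslope ρ 0 r ^ 2 := fun r => by simp only [hσe r]
  have hf0 : (fun r => 1 - dslope ρ 0 r ^ 2) 0 = 0 := by simp [h1]
  have hfo := odd_dslope_of_even hfe hf0
  refine ⟨hσ, contDiff_dslope_zero (contDiff_dslope_zero hf), hσe, even_dslope_of_odd hfo,
    fun r => ?_⟩
  have e1 := mul_dslope_zero (f := fun r => 1 - dslope ρ 0 r ^ 2) hf0 r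
  have e2 : r * polarCoeff ρ r = _ := mul_dslope_zero (Function.Odd.map_zero hfo) r
  linear_combination r * e2 + e1

lemma rotMetric_eq_radialMetric {n : ℕ} (hs : ContDiff ℝ ∞ ρ) (ho : ρ.Odd)
    (h1 : deriv ρ 0 = 1) :
    rotMetric n ρ = radialMetric (dslope ρ 0) (polarCoeff ρ) := by
  have hp := isPolar_of_odd hs ho h1
  funext x
  refine ContinuousLinearMap.ext fun u => ContinuousLinearMap.ext fun v => ?_
  rw [radialMetric_apply, rotMetric]
  split_ifs with hx
  · subst hx
    simp [h1, euclid]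
    rfl
  · have hx' : ‖x‖ ≠ 0 := norm_ne_zero_iff.2 hx
    have e := hp.radial ‖x‖
    have e2 := mul_dslope_zero (Function.Odd.map_zero ho) ‖x‖
    have hb : polarCoeff ρ ‖x‖ = (1 - dslope ρ 0 ‖x‖ ^ 2) / ‖x‖ ^ 2 := by
      field_simp
      linear_combination e
    rw [hb, ← e2]
    change (‖x‖ ^ 2)⁻¹ * (⟪x, u⟫ * ⟪x, v⟫) + (‖x‖ * dslope ρ 0 ‖x‖) ^ 2 *
      ((‖x‖ ^ 2)⁻¹ * (⟪u, v⟫ - (‖x‖ ^ 2)⁻¹ * (⟪x, u⟫ * ⟪x, v⟫))) = _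
    field_simp
    ring

/-- The derivative of `ρ (r) = r σ (r)`, where `σ = dslope ρ 0`. -/
lemma hasDerivAt_of_odd (hs : ContDiff ℝ ∞ ρ) (ho : ρ.Odd) (r : ℝ) :
    HasDerivAt ρ (dslope ρ 0 r + r ^ 2 * radialDeriv (dslope ρ 0) r) r := by
  have h := (hasDerivAt_id r).mul
    ((contDiff_dslope_zero hs).differentiable (by simp) r).hasDerivAt
  rw [← mul_radialDeriv (even_dslope_of_odd ho)] at h
  have e : (id * dslope ρ 0) = ρ := funext (mul_dslope_zero (Function.Odd.map_zero ho))
  rw [e] at h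
  exact h.congr_deriv (by simp; ring)

lemma hasDerivAt_deriv_of_odd (hs : ContDiff ℝ ∞ ρ) (ho : ρ.Odd) (r : ℝ) :
    HasDerivAt (deriv ρ) (r * (3 * radialDeriv (dslope ρ 0) r +
      r ^ 2 * radialDeriv (radialDeriv (dslope ρ 0)) r)) r := by
  have hσ := contDiff_dslope_zero hs
  have hσe := even_dslope_of_odd ho
  have h1 := (hσ.differentiable (by simp) r).hasDerivAt
  have h2 := ((contDiff_radialDeriv hσ).differentiable (by simp) r).hasDerivAt
  rw [← mul_radialDeriv hσe] at h1
  rw [← mul_radialDeriv (even_radialDeriv hσe)] at h2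
  have h := h1.add ((hasDerivAt_pow 2 r).mul h2)
  rw [show deriv ρ = _ from funext fun r => (hasDerivAt_of_odd hs ho r).deriv]
  exact h.congr_deriv (by simp; ring)

lemma iteratedDeriv_three_zero_of_odd (hs : ContDiff ℝ ∞ ρ) (ho : ρ.Odd) :
    iteratedDeriv 3 ρ 0 = 3 * radialDeriv (dslope ρ 0) 0 := by
  have hσ := contDiff_dslope_zero hs
  have h2 := ((contDiff_radialDeriv hσ).differentiable (by simp) 0).hasDerivAt
  have h3 := ((contDiff_radialDeriv (contDiff_radialDeriv hσ)).differentiable (by simp)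
    0).hasDerivAt
  rw [iteratedDeriv_succ, iteratedDeriv_succ, iteratedDeriv_one,
    show deriv (deriv ρ) = _ from funext fun r => (hasDerivAt_deriv_of_odd hs ho r).deriv]
  have h := (hasDerivAt_id (0 : ℝ)).mul ((h2.const_mul 3).add ((hasDerivAt_pow 2 0).mul h3))
  refine h.deriv.trans ?_
  simp

lemma tanCurv_of_odd (hs : ContDiff ℝ ∞ ρ) (ho : ρ.Odd) (h1 : deriv ρ 0 = 1) {r : ℝ}
    (hr : r ≠ 0) (h0 : ρ r ≠ 0) :
    tanCurv (dslope ρ 0) (polarCoeff ρ) r = (1 - deriv ρ r ^ 2) / ρ r ^ 2 := by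
  have e := (isPolar_of_odd hs ho h1).radial r
  have e2 := mul_dslope_zero (Function.Odd.map_zero ho) r
  rw [(hasDerivAt_of_odd hs ho r).deriv, tanCurv]
  rw [← e2] at h0 ⊢
  have := right_ne_zero_of_mul h0
  field_simp
  linear_combination e

lemma tanCurv_zero (hs : ContDiff ℝ ∞ ρ) (ho : ρ.Odd) (h1 : deriv ρ 0 = 1) :
    tanCurv (dslope ρ 0) (polarCoeff ρ) 0 = -iteratedDeriv 3 ρ 0 := by
  have e := (isPolar_of_odd hs ho h1).radial_deriv 0
  rw [iteratedDeriv_three_zero_of_odd hs ho, tanCurv]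
  simp only [dslope_same, h1] at e ⊢
  linear_combination e / 2

/-- The radial sectional curvature `α + r² β` is `-ρ'' / ρ`. -/
lemma radCurv_of_odd (hs : ContDiff ℝ ∞ ρ) (ho : ρ.Odd) (h1 : deriv ρ 0 = 1) {r : ℝ}
    (hr : r ≠ 0) (h0 : ρ r ≠ 0) :
    tanCurv (dslope ρ 0) (polarCoeff ρ) r + r ^ 2 * curvDiff (dslope ρ 0) (polarCoeff ρ) r =
      -(deriv (deriv ρ) r / ρ r) := by
  have e := (isPolar_of_odd hs ho h1).radial_deriv r
  have e2 := mul_dslope_zero (Function.Odd.map_zero ho) r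
  rw [(hasDerivAt_deriv_of_odd hs ho r).deriv, tanCurv, curvDiff]
  rw [← e2] at h0 ⊢
  have := right_ne_zero_of_mul h0
  field_simp
  linear_combination e

variable {R : ENNReal}

lemma isOpen_profileDomain (R : ENNReal) : IsOpen {r : ℝ | ENNReal.ofReal |r| < R} :=
  isOpen_lt (ENNReal.continuous_ofReal.comp continuous_abs) continuous_const

lemma IsProfile.contDiffAt (h : IsProfile R ρ) {r : ℝ} (hr : ENNReal.ofReal |r| < R) :
    ContDiffAt ℝ ∞ ρ r := h.smooth.contDiffAt ((isOpen_profileDomain R).mem_nhds hr)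

/-- A profile agrees on every smaller interval with an odd function that is smooth on the whole
line. -/
lemma IsProfile.exists_extension (h : IsProfile R ρ) {r : ℝ} (h0 : 0 ≤ r)
    (hr : ENNReal.ofReal r < R) :
    ∃ f : ℝ → ℝ, ∃ r₁, r < r₁ ∧ ContDiff ℝ ∞ f ∧ f.Odd ∧
      ∀ s, |s| < r₁ → f s = ρ s ∧ ENNReal.ofReal |s| < R := by
  obtain ⟨r₂, hr₂, h2R⟩ : ∃ r₂, r < r₂ ∧ ENNReal.ofReal r₂ < R := by
    obtain ⟨q, hq1, hq2⟩ := ENNReal.lt_iff_exists_nnreal_btwn.1 hr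
    refine ⟨q, ?_, by simpa using hq2⟩
    exact (ENNReal.ofReal_lt_ofReal_iff' (q := (q : ℝ))).1 (by simpa using hq1) |>.1
  obtain ⟨r₁, h1, h12⟩ := exists_between hr₂
  have hin : ∀ s, |s| ≤ r₂ → ENNReal.ofReal |s| < R := fun s hs =>
    (ENNReal.ofReal_le_ofReal hs).trans_lt h2R
  let χ : ContDiffBump (0 : ℝ) := ⟨r₁, r₂, h0.trans_lt h1, h12⟩
  have hχ : ∀ s, r₂ ≤ |s| → χ s = 0 := fun s hs => χ.zero_of_le_dist (by simpa using hs)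
  refine ⟨fun s => χ s * ρ s, r₁, h1, ?_, ?_, fun s hs => ⟨?_, hin s (hs.trans h12).le⟩⟩
  · refine contDiff_iff_contDiffAt.2 fun s => ?_
    rcases le_or_gt |s| r₂ with hs | hs
    · exact χ.contDiffAt.mul (h.contDiffAt (hin s hs))
    · refine (contDiffAt_const (c := (0 : ℝ))).congr_of_eventuallyEq ?_
      filter_upwards [(isOpen_lt continuous_const continuous_abs).mem_nhds hs] with t ht
      rw [hχ t (le_of_lt ht), zero_mul]
  · intro s
    change χ (-s) * ρ (-s) = -(χ s * ρ s)
    rw [χ.neg]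
    rcases le_or_gt |s| r₂ with hs | hs
    · rw [h.odd s (hin s hs)]
      ring
    · simp [hχ s hs.le]
  · change χ s * ρ s = ρ s
    rw [χ.one_of_mem_closedBall (by simpa using hs.le), one_mul]

/-- Near each of its points the rotational factor has polar coefficients, from which the curvature
is expressed through the profile. -/
lemma IsProfile.exists_polar {n : ℕ} (h : IsProfile R ρ) {x : EuclideanSpace ℝ (Fin n)}
    (hx : x ∈ rotDomain n R) :
    ∃ a b : ℝ → ℝ, IsPolar a b ∧ a ‖x‖ ≠ 0 ∧ rotMetric n ρ =ᶠ[nhds x] radialMetric a b ∧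
      (x = 0 → tanCurv a b ‖x‖ = -iteratedDeriv 3 ρ 0) ∧
      (x ≠ 0 → tanCurv a b ‖x‖ = (1 - deriv ρ ‖x‖ ^ 2) / ρ ‖x‖ ^ 2 ∧
        tanCurv a b ‖x‖ + ‖x‖ ^ 2 * curvDiff a b ‖x‖ = -(deriv (deriv ρ) ‖x‖ / ρ ‖x‖)) := by
  obtain ⟨f, r₁, hr, hs, ho, hf⟩ := h.exists_extension (norm_nonneg x) hx
  have heq : ∀ s, |s| < r₁ → f =ᶠ[nhds s] ρ := fun s hs => by
    filter_upwards [(isOpen_lt continuous_abs continuous_const).mem_nhds hs] with t ht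
    exact (hf t ht).1
  have h0 : |(0 : ℝ)| < r₁ := by simpa using (norm_nonneg x).trans_lt hr
  have hx1 : |‖x‖| < r₁ := by rwa [abs_norm]
  have h1 : deriv f 0 = 1 := by rw [(heq 0 h0).deriv_eq, h.deriv_zero]
  have hpos : x ≠ 0 → f ‖x‖ ≠ 0 := fun hx0 => by
    rw [(hf _ hx1).1]
    exact (h.pos _ (norm_pos_iff.2 hx0) hx).ne'
  refine ⟨dslope f 0, polarCoeff f, isPolar_of_odd hs ho h1, ?_, ?_, fun hx0 => ?_, fun hx0 => ?_⟩
  · rcases eq_or_ne x 0 with rfl | hx0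
    · simp [h1]
    · intro h
      apply hpos hx0
      rw [← mul_dslope_zero (Function.Odd.map_zero ho), h, mul_zero]
  · rw [← rotMetric_eq_radialMetric hs ho h1]
    filter_upwards [(isOpen_lt continuous_norm continuous_const).mem_nhds hr] with y hy
    simp only [rotMetric, (hf ‖y‖ (by rw [abs_norm]; exact hy)).1]
  · rw [hx0, norm_zero, tanCurv_zero hs ho h1, (heq 0 h0).iteratedDeriv_eq]
  · have hn := norm_ne_zero_iff.2 hx0
    rw [radCurv_of_odd hs ho h1 hn (hpos hx0), tanCurv_of_odd hs ho h1 hn (hpos hx0),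
      (heq _ hx1).deriv_eq, (heq _ hx1).deriv.deriv_eq, (hf _ hx1).1]
    exact ⟨rfl, rfl⟩

lemma isRiemannianMetricOn_rot {n : ℕ} (h : IsProfile R ρ) :
    IsRiemannianMetricOn (rotMetric n ρ) (rotDomain n R) where
  isOpen := isOpen_lt (ENNReal.continuous_ofReal.comp continuous_norm) continuous_const
  smooth x hx := by
    obtain ⟨a, b, hab, -, heq, -⟩ := h.exists_polar hx
    exact ((contDiff_radialMetric hab).contDiffAt.congr_of_eventuallyEq heq).contDiffWithinAt
  symm x hx u v := by
    obtain ⟨a, b, -, -, heq, -⟩ := h.exists_polar hx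
    rw [heq.eq_of_nhds, radialMetric_apply, radialMetric_apply, real_inner_comm]
    ring
  pos x hx v hv := by
    obtain ⟨a, b, hab, hx0, heq, -⟩ := h.exists_polar hx
    rw [heq.eq_of_nhds]
    exact radialMetric_pos hab hx0 hv

/-- The curvature form of the rotational factor. The radial planes have sectional curvature
`-ρ'' / ρ`, the tangential ones `(1 - ρ'²) / ρ²`, and the pole `-ρ''' (0)`. -/
lemma IsProfile.exists_curvForm {n : ℕ} (h : IsProfile R ρ) {x : EuclideanSpace ℝ (Fin n)}
    (hx : x ∈ rotDomain n R) :
    rotMetric n ρ x x x = ‖x‖ ^ 2 ∧ ∃ α β : ℝ,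
      (∀ u v, curvForm (rotMetric n ρ) x u v =
        α * area (rotMetric n ρ x) u v + β * radialArea (rotMetric n ρ x) x u v) ∧
      (x = 0 → α = -iteratedDeriv 3 ρ 0) ∧
      (x ≠ 0 → α = (1 - deriv ρ ‖x‖ ^ 2) / ρ ‖x‖ ^ 2 ∧
        α + ‖x‖ ^ 2 * β = -(deriv (deriv ρ) ‖x‖ / ρ ‖x‖)) := by
  obtain ⟨a, b, hab, hx0, heq, h1, h2⟩ := h.exists_polar hx
  refine ⟨?_, _, _, fun u v => ?_, h1, h2⟩
  · rw [heq.eq_of_nhds, hab.radialMetric_self, real_inner_self_eq_norm_sq]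
  · rw [curvForm_congr heq, heq.eq_of_nhds, curvForm_radialMetric hab hx0]

end Profile

/-! ### Space form profiles -/

/-- The derivative of `spaceFormProfile c`. -/
def spaceFormCos (c r : ℝ) : ℝ :=
  open Classical in
  if 0 < c then Real.cos (√c * r)
  else if c < 0 then Real.cosh (√(-c) * r)
  else 1

lemma hasDerivAt_spaceFormProfile (c r : ℝ) :
    HasDerivAt (spaceFormProfile c) (spaceFormCos c r) r := by
  unfold spaceFormProfile spaceFormCos
  split_ifs with h1 h2
  · have hc : √c ≠ 0 := (Real.sqrt_pos.2 h1).ne'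
    have := (((hasDerivAt_id r).const_mul (√c)).sin).div_const (√c)
    refine this.congr_deriv ?_
    simp [hc]
  · have hc : √(-c) ≠ 0 := (Real.sqrt_pos.2 (neg_pos.2 h2)).ne'
    have := (((hasDerivAt_id r).const_mul (√(-c))).sinh).div_const (√(-c))
    refine this.congr_deriv ?_
    simp [hc]
  · exact hasDerivAt_id r

lemma hasDerivAt_spaceFormCos (c r : ℝ) :
    HasDerivAt (spaceFormCos c) (-c * spaceFormProfile c r) r := by
  unfold spaceFormProfile spaceFormCos
  split_ifs with h1 h2
  · have hc : √c ≠ 0 := (Real.sqrt_pos.2 h1).ne'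
    refine ((hasDerivAt_id r).const_mul (√c)).cos.congr_deriv ?_
    have := Real.sq_sqrt h1.le
    field_simp
    simp only [id]
    linear_combination -Real.sin (√c * r) * this
  · have hc : √(-c) ≠ 0 := (Real.sqrt_pos.2 (neg_pos.2 h2)).ne'
    refine ((hasDerivAt_id r).const_mul (√(-c))).cosh.congr_deriv ?_
    have := Real.sq_sqrt (neg_pos.2 h2).le
    field_simp
    simp only [id]
    linear_combination Real.sinh (√(-c) * r) * this
  · have : c = 0 := le_antisymm (not_lt.1 h1) (not_lt.1 h2)
    simpa [this] using hasDerivAt_const r (1 : ℝ)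

lemma spaceFormProfile_zero (c : ℝ) : spaceFormProfile c 0 = 0 := by
  simp [spaceFormProfile]

lemma spaceFormCos_zero (c : ℝ) : spaceFormCos c 0 = 1 := by
  simp [spaceFormCos]

lemma spaceFormProfile_neg (c r : ℝ) : spaceFormProfile c (-r) = -spaceFormProfile c r := by
  unfold spaceFormProfile
  split_ifs <;> simp [neg_div]

lemma spaceFormCos_sq (c r : ℝ) : spaceFormCos c r ^ 2 + c * spaceFormProfile c r ^ 2 = 1 := by
  unfold spaceFormProfile spaceFormCos
  split_ifs with h1 h2
  · rw [div_pow, Real.sq_sqrt h1.le, mul_div_cancel₀ _ h1.ne', Real.cos_sq_add_sin_sq]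
  · rw [div_pow, Real.sq_sqrt (neg_pos.2 h2).le, Real.cosh_sq]
    have : c * c⁻¹ = 1 := mul_inv_cancel₀ h2.ne
    linear_combination -Real.sinh (√(-c) * r) ^ 2 * this
  · have : c = 0 := le_antisymm (not_lt.1 h1) (not_lt.1 h2)
    simp [this]

lemma eq_of_hasDerivAt_zero {f : ℝ → ℝ} {r : ℝ} (hr : 0 ≤ r) (hc : ContinuousOn f (Set.Icc 0 r))
    (hd : ∀ s, 0 < s → s < r → HasDerivAt f 0 s) : f r = f 0 := by
  rcases hr.eq_or_lt with rfl | hr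
  · rfl
  · obtain ⟨s, -, hs⟩ := exists_hasDerivAt_eq_slope f (fun _ => 0) hr hc fun s hs => hd s hs.1 hs.2
    rw [eq_comm, div_eq_zero_iff] at hs
    rcases hs with hs | hs <;> linarith

section

variable {R : ENNReal} {ρ : ℝ → ℝ}

lemma IsProfile.hasDerivAt (h : IsProfile R ρ) {r : ℝ} (hr : ENNReal.ofReal |r| < R) :
    HasDerivAt ρ (deriv ρ r) r :=
  ((h.contDiffAt hr).differentiableAt (by simp)).hasDerivAt

lemma IsProfile.hasDerivAt_deriv (h : IsProfile R ρ) {r : ℝ} (hr : ENNReal.ofReal |r| < R) :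
    HasDerivAt (deriv ρ) (deriv (deriv ρ) r) r :=
  (((h.smooth.deriv_of_isOpen (m := ∞) (isOpen_profileDomain R) (by simp)).contDiffAt
    ((isOpen_profileDomain R).mem_nhds hr)).differentiableAt (by simp)).hasDerivAt

lemma IsProfile.map_zero (h : IsProfile R ρ) (hR : 0 < R) : ρ 0 = 0 := by
  have := h.odd 0 (by simpa using hR)
  rw [neg_zero] at this
  linarith

/-- A profile with `ρ'' = -c ρ` is the profile of the space form of curvature `c`: its Wronskians
with the two fundamental solutions of this equation are constant. -/
lemma IsProfile.eq_spaceFormProfile (h : IsProfile R ρ) {c : ℝ}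
    (hode : ∀ r, 0 < r → ENNReal.ofReal r < R → deriv (deriv ρ) r = -c * ρ r) {r : ℝ}
    (h0 : 0 ≤ r) (hr : ENNReal.ofReal r < R) : ρ r = spaceFormProfile c r := by
  have hin : ∀ s, 0 ≤ s → s ≤ r → ENNReal.ofReal |s| < R := fun s hs hsr => by
    rw [abs_of_nonneg hs]
    exact (ENNReal.ofReal_le_ofReal hsr).trans_lt hr
  have hR : 0 < R := bot_le.trans_lt hr
  have w1 : ∀ s, 0 ≤ s → s ≤ r → HasDerivAt
      (fun r => ρ r * spaceFormCos c r - deriv ρ r * spaceFormProfile c r) _ s := fun s hs hsr =>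
    ((h.hasDerivAt (hin s hs hsr)).mul (hasDerivAt_spaceFormCos c s)).sub
      ((h.hasDerivAt_deriv (hin s hs hsr)).mul (hasDerivAt_spaceFormProfile c s))
  have w2 : ∀ s, 0 ≤ s → s ≤ r → HasDerivAt
      (fun r => c * (ρ r * spaceFormProfile c r) + deriv ρ r * spaceFormCos c r) _ s :=
    fun s hs hsr =>
    (((h.hasDerivAt (hin s hs hsr)).mul (hasDerivAt_spaceFormProfile c s)).const_mul c).add
      ((h.hasDerivAt_deriv (hin s hs hsr)).mul (hasDerivAt_spaceFormCos c s))
  have e1 := eq_of_hasDerivAt_zero h0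
    (fun s hs => (w1 s hs.1 hs.2).continuousAt.continuousWithinAt) fun s hs hsr =>
      (w1 s hs.le hsr.le).congr_deriv (by
        rw [hode s hs (by simpa [abs_of_pos hs] using hin s hs.le hsr.le)]; ring)
  have e2 := eq_of_hasDerivAt_zero h0
    (fun s hs => (w2 s hs.1 hs.2).continuousAt.continuousWithinAt) fun s hs hsr =>
      (w2 s hs.le hsr.le).congr_deriv (by
        rw [hode s hs (by simpa [abs_of_pos hs] using hin s hs.le hsr.le)]; ring)
  simp only [h.map_zero hR, h.deriv_zero, spaceFormProfile_zero, spaceFormCos_zero] at e1 e2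
  linear_combination spaceFormCos c r * e1 + spaceFormProfile c r * e2 - ρ r * spaceFormCos_sq c r

/-- If `κ_rot` is constant, then `ρ` is the profile of a space form: the function `ρⁿ⁻² (1 - ρ'²) - C ρⁿ` is a
first integral of the equation `κ_rot = n (n - 1) C`, and it vanishes at `0`. -/
lemma IsProfile.exists_eq_spaceFormProfile (h : IsProfile R ρ) {n : ℕ} (hn : 2 ≤ n) {K : ℝ}
    (hK : ∀ r, 0 ≤ r → ENNReal.ofReal r < R → kappaRot n ρ r = K) :
    ∃ c : ℝ, ∀ r : ℝ, 0 ≤ r → ENNReal.ofReal r < R → ρ r = spaceFormProfile c r := by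
  obtain ⟨m, rfl⟩ := Nat.exists_eq_add_of_le hn
  set c : ℝ := K / ((m + 2) * (m + 1)) with hc
  have hm : (0 : ℝ) ≤ m := m.cast_nonneg
  have hKc : K = (m + 2) * (m + 1) * c := by rw [hc]; field_simp
  have hρ : ∀ r, 0 < r → ENNReal.ofReal r < R →
      -2 * deriv (deriv ρ) r * ρ r + m * (1 - deriv ρ r ^ 2) = (m + 2) * c * ρ r ^ 2 := by
    intro r h0 hr
    have h1 := hK r h0.le hr
    have hp := h.pos r h0 hr
    rw [kappaRot, if_neg h0.ne', hKc] at h1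
    push_cast at h1
    have hm1 : (m : ℝ) + 1 ≠ 0 := by positivity
    have h2 : (-2 * (deriv (deriv ρ) r / ρ r) + m * ((1 - deriv ρ r ^ 2) / ρ r ^ 2)) =
        (m + 2) * c := by
      apply mul_left_cancel₀ hm1
      linear_combination h1
    field_simp at h2
    linear_combination h2
  refine ⟨c, fun r h0 hr => h.eq_spaceFormProfile (fun r h0 hr => ?_) h0 hr⟩
  have hin : ∀ s, 0 ≤ s → s ≤ r → ENNReal.ofReal |s| < R := fun s hs hsr => by
    rw [abs_of_nonneg hs]
    exact (ENNReal.ofReal_le_ofReal hsr).trans_lt hr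
  have hR : 0 < R := bot_le.trans_lt hr
  have hd : ∀ s, 0 ≤ s → s ≤ r → HasDerivAt
      (fun r => ρ r ^ m * (1 - deriv ρ r ^ 2) - c * ρ r ^ (m + 2)) _ s := fun s hs hsr =>
    (((h.hasDerivAt (hin s hs hsr)).pow m).mul
      (((h.hasDerivAt_deriv (hin s hs hsr)).pow 2).const_sub 1)).sub
      (((h.hasDerivAt (hin s hs hsr)).pow (m + 2)).const_mul c)
  have e := eq_of_hasDerivAt_zero h0.le
    (fun s hs => (hd s hs.1 hs.2).continuousAt.continuousWithinAt) fun s hs hsr =>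
      (hd s hs.le hsr.le).congr_deriv (by
        have hsR : ENNReal.ofReal s < R := by simpa [abs_of_pos hs] using hin s hs.le hsr.le
        have h1 := hρ s hs hsR
        have h2 := (h.pos s hs hsR).ne'
        apply mul_left_cancel₀ h2
        -- the truncated exponent `m - 1` is harmless: for `m = 0` the factor `m` vanishes
        have h3 : (m : ℝ) * ρ s ^ (m - 1) * ρ s = m * ρ s ^ m := by
          rcases m with _ | m
          · simp
          · simp [pow_succ, mul_assoc]
        simp only [Pi.pow_apply, show m + 2 - 1 = m + 1 from rfl]
        push_cast
        linear_combination deriv ρ s * (1 - deriv ρ s ^ 2) * h3 + ρ s ^ m * deriv ρ s * h1)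
  simp only [h.map_zero hR, h.deriv_zero] at e
  have hp := h.pos r h0 hr
  have e' : 1 - deriv ρ r ^ 2 = c * ρ r ^ 2 := by
    apply mul_left_cancel₀ (pow_pos hp m).ne'
    linear_combination e
  apply mul_left_cancel₀ hp.ne'
  linear_combination (-1 / 2 : ℝ) * hρ r h0 hr + (m / 2 : ℝ) * e'

/-- The rotational factor with a space form profile of curvature `c` has constant sectional
curvature `c`. -/
lemma IsProfile.curvForm_of_spaceFormProfile (h : IsProfile R ρ) {c : ℝ}
    (hc : ∀ r : ℝ, 0 ≤ r → ENNReal.ofReal r < R → ρ r = spaceFormProfile c r) {n : ℕ}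
    {x : EuclideanSpace ℝ (Fin n)} (hx : x ∈ rotDomain n R) (u v : EuclideanSpace ℝ (Fin n)) :
    curvForm (rotMetric n ρ) x u v = c * area (rotMetric n ρ x) u v := by
  -- both functions are odd, so that they agree on `(-R, R)` and have the same derivatives at `0`
  have heq : ∀ r, ENNReal.ofReal |r| < R → ρ =ᶠ[nhds r] spaceFormProfile c := fun r hr => by
    filter_upwards [(isOpen_profileDomain R).mem_nhds hr] with s hs
    rcases le_total 0 s with h0 | h0
    · exact hc s h0 (by simpa [abs_of_nonneg h0] using hs)
    · have h1 := h.odd s hs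
      have h2 := hc (-s) (neg_nonneg.2 h0) (by simpa [abs_of_nonpos h0] using hs)
      rw [spaceFormProfile_neg] at h2
      linarith
  have d1 : deriv (spaceFormProfile c) = spaceFormCos c :=
    funext fun r => (hasDerivAt_spaceFormProfile c r).deriv
  have d2 : deriv (spaceFormCos c) = fun r => -c * spaceFormProfile c r :=
    funext fun r => (hasDerivAt_spaceFormCos c r).deriv
  obtain ⟨-, α, β, hαβ, hz, hnz⟩ := h.exists_curvForm hx
  rw [hαβ]
  rcases eq_or_ne x 0 with rfl | hx0
  · have hr : ENNReal.ofReal |(0 : ℝ)| < R := by simpa [rotDomain] using hx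
    have hα : α = c := by
      rw [hz rfl, (heq 0 hr).iteratedDeriv_eq, iteratedDeriv_succ, iteratedDeriv_succ,
        iteratedDeriv_one, d1, d2, ((hasDerivAt_spaceFormProfile c 0).const_mul (-c)).deriv,
        spaceFormCos_zero]
      ring
    -- at the pole the radial covector vanishes, and `β` plays no role
    simp [hα, radialArea]
  · have hr : ENNReal.ofReal |‖x‖| < R := by rw [abs_norm]; exact hx
    have hn : ‖x‖ ≠ 0 := norm_ne_zero_iff.2 hx0
    obtain ⟨h1, h2⟩ := hnz hx0
    have hp := (h.pos _ (norm_pos_iff.2 hx0) hx).ne'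
    rw [(heq _ hr).deriv_eq, d1, (heq _ hr).eq_of_nhds] at h1
    rw [(heq _ hr).deriv.deriv_eq, d1, d2, (heq _ hr).eq_of_nhds] at h2
    rw [(heq _ hr).eq_of_nhds] at hp
    have hα : α = c := by
      rw [h1, div_eq_iff (pow_ne_zero 2 hp)]
      linear_combination -spaceFormCos_sq c ‖x‖
    have hβ : β = 0 := by
      have : ‖x‖ ^ 2 * β = 0 := by
        simp only [neg_mul] at h2
        rw [neg_div, neg_neg, mul_div_cancel_right₀ _ hp, hα] at h2
        linarith
      exact (mul_eq_zero.1 this).resolve_left (pow_ne_zero 2 hn)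
    rw [hα, hβ, zero_mul, add_zero]

end

lemma isProfile_cubic (R : ENNReal) : IsProfile R fun r => r + r ^ 3 where
  smooth := by fun_prop
  odd r _ := by ring
  pos r hr _ := by positivity
  deriv_zero := by
    have : HasDerivAt (fun r : ℝ => r + r ^ 3) _ 0 :=
      (hasDerivAt_id (0 : ℝ)).add (hasDerivAt_pow 3 (0 : ℝ))
    rw [this.deriv]
    simp

/-! ### The rotational product -/

section Product

variable {k : ℕ} {d : Fin k → ℕ} {κ : Fin k → ℝ} {n : ℕ} {R : ENNReal} {ρ : ℝ → ℝ}

lemma isRiemannianMetricOn_hom (d : Fin k → ℕ) (κ : Fin k → ℝ) :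
    IsRiemannianMetricOn (homMetric d κ) (homDomain d κ) :=
  IsRiemannianMetricOn.pi fun m => isRiemannianMetricOn_stereo (κ m) (d m)

lemma isRiemannianMetricOn_rotProduct (h : IsProfile R ρ) :
    IsRiemannianMetricOn (rotProductMetric d κ n ρ) (rotProduct d κ n R) :=
  (isRiemannianMetricOn_hom d κ).prod (isRiemannianMetricOn_rot h)

lemma curvForm_hom {p : ∀ m, EuclideanSpace ℝ (Fin (d m))} (hp : p ∈ homDomain d κ)
    (u v : ∀ m, EuclideanSpace ℝ (Fin (d m))) :
    curvForm (homMetric d κ) p u v =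
      ∑ m, κ m * area (stereoMetric (κ m) (d m) (p m)) (u m) (v m) := by
  rw [homMetric, curvForm_pi (fun m => isRiemannianMetricOn_stereo (κ m) (d m)) hp]
  exact Finset.sum_congr rfl fun m _ => curvForm_stereo (hp m) _ _

lemma homMetric_single (p v : ∀ m, EuclideanSpace ℝ (Fin (d m))) (m : Fin k)
    (w : EuclideanSpace ℝ (Fin (d m))) :
    homMetric d κ p (Pi.single m w) v = stereoMetric (κ m) (d m) (p m) w (v m) := by
  rw [homMetric, piMetric_apply, Finset.sum_eq_single m]
  · simp
  · intro j _ hj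
    simp [hj]
  · simp

lemma hasCurvature_hom {p : ∀ m, EuclideanSpace ℝ (Fin (d m))} (hp : p ∈ homDomain d κ) :
    HasCurvature (homMetric d κ) p (kappaHom d κ) := by
  have hg := isRiemannianMetricOn_hom d κ
  refine hasCurvature_of_sum (hg.symm p hp) (hg.pos p hp) (fun u => ?_) fun e he => ?_
  · simp [curvForm_hom hp, area_self]
  · have hm := fun m => he.sum_area (B := stereoMetric (κ m) (d m) (p m))
      (pr := LinearMap.proj m) (inc := LinearMap.single ℝ (fun m => EuclideanSpace ℝ (Fin (d m))) m) (by simp)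
      (fun v w => homMetric_single p v m w)
    simp only [LinearMap.proj_apply, finrank_euclideanSpace, Fintype.card_fin] at hm
    simp only [curvForm_hom hp]
    simp_rw [Finset.sum_comm (s := (Finset.univ : Finset (Fin (Module.finrank ℝ _))))
      (t := (Finset.univ : Finset (Fin k)))]
    rw [kappaHom]
    refine Finset.sum_congr rfl fun m _ => ?_
    simp only [← Finset.mul_sum, hm]
    ring

lemma curvForm_rotProduct (h : IsProfile R ρ)
    {x : (∀ m, EuclideanSpace ℝ (Fin (d m))) × EuclideanSpace ℝ (Fin n)}
    (hx : x ∈ rotProduct d κ n R)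
    (u v : (∀ m, EuclideanSpace ℝ (Fin (d m))) × EuclideanSpace ℝ (Fin n)) :
    curvForm (rotProductMetric d κ n ρ) x u v =
      ∑ m, κ m * area (stereoMetric (κ m) (d m) (x.1 m)) (u.1 m) (v.1 m) +
        curvForm (rotMetric n ρ) x.2 u.2 v.2 := by
  rw [rotProductMetric, curvForm_prod (isRiemannianMetricOn_hom d κ) (isRiemannianMetricOn_rot h)
    hx, curvForm_hom hx.1]

lemma hasCurvature_rotProduct (h : IsProfile R ρ)
    {x : (∀ m, EuclideanSpace ℝ (Fin (d m))) × EuclideanSpace ℝ (Fin n)}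
    (hx : x ∈ rotProduct d κ n R) :
    HasCurvature (rotProductMetric d κ n ρ) x (kappaHom d κ + kappaRot n ρ ‖x.2‖) := by
  have hg := isRiemannianMetricOn_rotProduct (d := d) (κ := κ) (n := n) h
  obtain ⟨hxx, α, β, hαβ, hz, hnz⟩ := h.exists_curvForm hx.2
  refine hasCurvature_of_sum (hg.symm x hx) (hg.pos x hx) (fun u => ?_) fun e he => ?_
  · simp [curvForm_rotProduct h hx, hαβ, area_self, radialArea_self]
  · have hm := fun m => he.sum_area (B := stereoMetric (κ m) (d m) (x.1 m))
      (pr := LinearMap.proj m ∘ₗ LinearMap.fst ℝ _ _)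
      (inc := LinearMap.inl ℝ _ _ ∘ₗ LinearMap.single ℝ (fun m => EuclideanSpace ℝ (Fin (d m))) m) (by simp)
      (fun v w => by simp [rotProductMetric, homMetric_single])
    have hF := he.sum_area (B := rotMetric n ρ x.2) (pr := LinearMap.snd ℝ _ _)
      (inc := LinearMap.inr ℝ _ _) (by simp) (fun v w => by simp [rotProductMetric])
    have hr := he.sum_radialArea (B := rotMetric n ρ x.2) (pr := LinearMap.snd ℝ _ _)
      (inc := LinearMap.inr ℝ _ _) (by simp) (fun v w => by simp [rotProductMetric]) x.2
    simp only [LinearMap.comp_apply, LinearMap.proj_apply, LinearMap.fst_apply,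
      LinearMap.snd_apply, finrank_euclideanSpace, Fintype.card_fin, hxx] at hm hF hr
    simp only [curvForm_rotProduct h hx, hαβ, Finset.sum_add_distrib, ← Finset.mul_sum, hF, hr]
    simp_rw [Finset.sum_comm (s := (Finset.univ : Finset (Fin (Module.finrank ℝ _))))
      (t := (Finset.univ : Finset (Fin k)))]
    have hP : ∑ m, ∑ i, ∑ j, κ m * area (stereoMetric (κ m) (d m) (x.1 m)) ((e i).1 m)
        ((e j).1 m) = kappaHom d κ := by
      rw [kappaHom]
      refine Finset.sum_congr rfl fun m _ => ?_
      simp only [← Finset.mul_sum, hm]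
      ring
    rw [hP]
    congr 1
    rw [kappaRot]
    rcases eq_or_ne x.2 0 with h0 | h0
    · rw [if_pos (by simp [h0]), hz h0, h0, norm_zero]
      ring
    · obtain ⟨h1, h2⟩ := hnz h0
      rw [if_neg (norm_ne_zero_iff.2 h0), ← h1]
      linear_combination 2 * ((n : ℝ) - 1) * h2

/-- Over a space form profile the rotational product is a product of space forms, and has the same
sectional curvature at any two points: the curvature form is a combination of the squared areas of
the factors, and these are preserved by a product of isometries. -/
lemma not_isHeterogeneous_of_spaceFormProfile (h : IsProfile R ρ) {c : ℝ}
    (hc : ∀ r : ℝ, 0 ≤ r → ENNReal.ofReal r < R → ρ r = spaceFormProfile c r) :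
    ¬ IsHeterogeneous (rotProductMetric d κ n ρ) (rotProduct d κ n R) := by
  rintro ⟨x, hx, y, hy, hne⟩
  apply hne
  have hS := fun m => isRiemannianMetricOn_stereo (κ m) (d m)
  have hR := isRiemannianMetricOn_rot (n := n) h
  choose L hL using fun m => exists_isometry ((hS m).symm _ (hx.1 m)) ((hS m).pos _ (hx.1 m))
    ((hS m).symm _ (hy.1 m)) ((hS m).pos _ (hy.1 m))
  obtain ⟨LF, hLF⟩ := exists_isometry (hR.symm _ hx.2) (hR.pos _ hx.2) (hR.symm _ hy.2)
    (hR.pos _ hy.2)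
  refine sameSectional_of_curvForm ((LinearEquiv.piCongrRight L).prodCongr LF) (fun u v => ?_)
    fun u v => ?_
  · simp [rotProductMetric, homMetric, hL, hLF]
  · rw [curvForm_rotProduct h hx, curvForm_rotProduct h hy,
      h.curvForm_of_spaceFormProfile hc hx.2, h.curvForm_of_spaceFormProfile hc hy.2]
    simp [area, hL, hLF]

lemma zero_mem_homDomain : (0 : ∀ m, EuclideanSpace ℝ (Fin (d m))) ∈ homDomain d κ := fun m => by
  simp [stereo]

lemma isHeterogeneous_of_kappaRot_ne (h : IsProfile R ρ) (hn : 2 ≤ n) {r s : ℝ} (hr : 0 ≤ r)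
    (hrR : ENNReal.ofReal r < R) (hs : 0 ≤ s) (hsR : ENNReal.ofReal s < R)
    (hne : kappaRot n ρ r ≠ kappaRot n ρ s) :
    IsHeterogeneous (rotProductMetric d κ n ρ) (rotProduct d κ n R) := by
  have : Nonempty (Fin n) := ⟨⟨0, by omega⟩⟩
  obtain ⟨z, hz⟩ := exists_norm_eq (EuclideanSpace ℝ (Fin n)) hr
  obtain ⟨w, hw⟩ := exists_norm_eq (EuclideanSpace ℝ (Fin n)) hs
  have hx : ((0, z) : (∀ m, EuclideanSpace ℝ (Fin (d m))) × EuclideanSpace ℝ (Fin n)) ∈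
      rotProduct d κ n R := ⟨zero_mem_homDomain, by
      change ENNReal.ofReal ‖z‖ < R
      rwa [hz]⟩
  have hy : ((0, w) : (∀ m, EuclideanSpace ℝ (Fin (d m))) × EuclideanSpace ℝ (Fin n)) ∈
      rotProduct d κ n R := ⟨zero_mem_homDomain, by
      change ENNReal.ofReal ‖w‖ < R
      rwa [hw]⟩
  refine ⟨_, hx, _, hy, fun hS => hne ?_⟩
  have := hS.hasCurvature_unique (hasCurvature_rotProduct h hx) (hasCurvature_rotProduct h hy)
  simpa [hz, hw] using this

end Product

/-- The profile `r + r³` has a rotational curvature that is different at the pole and elsewhere. -/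
lemma kappaRot_cubic_ne {n : ℕ} (hn : 2 ≤ n) {r : ℝ} (hr : 0 < r) :
    kappaRot n (fun r => r + r ^ 3) r ≠ kappaRot n (fun r => r + r ^ 3) 0 := by
  have d1 : deriv (fun r : ℝ => r + r ^ 3) = fun r => 1 + 3 * r ^ 2 := by
    funext r
    have : HasDerivAt (fun r : ℝ => r + r ^ 3) _ r := (hasDerivAt_id r).add (hasDerivAt_pow 3 r)
    rw [this.deriv]
    simp
  have d2 : deriv (fun r : ℝ => 1 + 3 * r ^ 2) = fun r => 6 * r := by
    funext r
    have : HasDerivAt (fun r : ℝ => 1 + 3 * r ^ 2) _ r :=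
      ((hasDerivAt_pow 2 r).const_mul 3).const_add 1
    rw [this.deriv]
    simp
    ring
  have d3 : deriv (fun r : ℝ => 6 * r) 0 = 6 := by
    simp
  intro h
  have hn' : (2 : ℝ) ≤ n := by exact_mod_cast hn
  rw [kappaRot, kappaRot, if_neg hr.ne', if_pos rfl, iteratedDeriv_succ, iteratedDeriv_succ,
    iteratedDeriv_one, d1, d2, d3] at h
  have h1 : (-2 * (6 * r / (r + r ^ 3)) +
      ((n : ℝ) - 2) * ((1 - (1 + 3 * r ^ 2) ^ 2) / (r + r ^ 3) ^ 2)) = -6 * n := by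
    apply mul_left_cancel₀ (show (n : ℝ) - 1 ≠ 0 by linarith)
    linear_combination h
  have hp : 0 < r + r ^ 3 := by positivity
  field_simp at h1
  have h2 : 0 < r ^ 4 * (3 * (n : ℝ) + 6 + 6 * n * r ^ 2) := by positivity
  nlinarith

end Riem

end

open Riem in
theorem proposition1 {k : ℕ} (d : Fin k → ℕ) (κ : Fin k → ℝ) (n : ℕ) (hn : 2 ≤ n)
    (R : ENNReal) (hR : 0 < R) :
    (∀ ρ : ℝ → ℝ, IsProfile R ρ →
      IsRiemannianMetricOn (rotProductMetric d κ n ρ) (rotProduct d κ n R) ∧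
      (∀ p ∈ homDomain d κ, HasCurvature (homMetric d κ) p (kappaHom d κ)) ∧
      (∀ x ∈ rotProduct d κ n R,
        HasCurvature (rotProductMetric d κ n ρ) x (kappaHom d κ + kappaRot n ρ ‖x.2‖)) ∧
      (IsHeterogeneous (rotProductMetric d κ n ρ) (rotProduct d κ n R) ↔
        ∃ r s : ℝ, 0 ≤ r ∧ ENNReal.ofReal r < R ∧ 0 ≤ s ∧ ENNReal.ofReal s < R ∧
          kappaRot n ρ r ≠ kappaRot n ρ s) ∧
      (IsHeterogeneous (rotProductMetric d κ n ρ) (rotProduct d κ n R) ↔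
        ¬ ∃ c : ℝ, ∀ r : ℝ, 0 ≤ r → ENNReal.ofReal r < R → ρ r = spaceFormProfile c r)) ∧
    ∃ ρ : ℝ → ℝ, IsProfile R ρ ∧
      IsHeterogeneous (rotProductMetric d κ n ρ) (rotProduct d κ n R) := by
  refine ⟨fun ρ h => ?_, fun r => r + r ^ 3, isProfile_cubic R, ?_⟩
  · have hto : (∃ r s : ℝ, 0 ≤ r ∧ ENNReal.ofReal r < R ∧ 0 ≤ s ∧ ENNReal.ofReal s < R ∧
        kappaRot n ρ r ≠ kappaRot n ρ s) →
        IsHeterogeneous (rotProductMetric d κ n ρ) (rotProduct d κ n R) :=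
      fun ⟨r, s, hr, hrR, hs, hsR, hne⟩ => isHeterogeneous_of_kappaRot_ne h hn hr hrR hs hsR hne
    have hnot : IsHeterogeneous (rotProductMetric d κ n ρ) (rotProduct d κ n R) →
        ¬ ∃ c : ℝ, ∀ r : ℝ, 0 ≤ r → ENNReal.ofReal r < R → ρ r = spaceFormProfile c r :=
      fun hh ⟨_, hc⟩ => not_isHeterogeneous_of_spaceFormProfile h hc hh
    have hex : (¬ ∃ c : ℝ, ∀ r : ℝ, 0 ≤ r → ENNReal.ofReal r < R → ρ r = spaceFormProfile c r) →
        ∃ r s : ℝ, 0 ≤ r ∧ ENNReal.ofReal r < R ∧ 0 ≤ s ∧ ENNReal.ofReal s < R ∧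
          kappaRot n ρ r ≠ kappaRot n ρ s := by
      intro hns
      by_contra hall
      push Not at hall
      exact hns (h.exists_eq_spaceFormProfile hn fun r hr hrR =>
        hall r 0 hr hrR le_rfl (by simpa using hR))
    exact ⟨isRiemannianMetricOn_rotProduct h, fun p hp => hasCurvature_hom hp,
      fun x hx => hasCurvature_rotProduct h hx, ⟨fun hh => hex (hnot hh), hto⟩,
      ⟨hnot, fun hns => hto (hex hns)⟩⟩
  · obtain ⟨q, hq0, hqR⟩ := ENNReal.lt_iff_exists_nnreal_btwn.1 hR
    have hq : (0 : ℝ) < q := by exact_mod_cast hq0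
    exact isHeterogeneous_of_kappaRot_ne (isProfile_cubic R) hn hq.le (by simpa using hqR) le_rfl
      (by simpa using hR) (kappaRot_cubic_ne hn hq)
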